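/- **Definitions.** Let $X$ be a standard Borel space. A *measured graph* $(\mathcal G,X,\mu)$ is a graph on $X$ with Borel edge set and countable degrees, together with a Borel probability measure $\mu$ that is quasi-invariant (the union of the orbits, i.e. connected components, meeting a $\mu$-null set is $\mu$-null). Suppose below that the vertex degrees are bounded. - $(\mathcal G,X,\mu)$ is *of bounded type* if $\mathcal G$ is the graph of a Borel action of a group $\Gamma$ with a finite symmetric generating set $\Sigma$ (distinct $x,y$ are adjacent iff $y=\sigma x$ for some $\sigma\in\Sigma$) such that for every $\gamma\in\Gamma$ the Radon–Nikodym derivative $R_\gamma$, given by $\mu(\gamma A)=\int_A R_\gamma\,d\mu$, is (essentially) bounded. - It is *uniformly hyperfinite* if for every $\varepsilon>0$ there is $K\ge 1$ such that for every Borel set $A\subseteq X$ of positive measure there is a Borel set $T\subseteq A$ with $\mu(T)<\varepsilon\mu(A)$ such that all components of the graph induced on $A\setminus T$ have at most $K$ vertices. - It is *uniformly amenable* if for every $\varepsilon>0$ there are $R\ge1$, an invariant Borel set $Y\subseteq X$ of full measure and a Borel map $p:Y\to\mathrm{Prob}(Y)$ such that for all $x\in Y$, $p(x)$ is supported on the ball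 of radius $R$ around $x$ and $\sum_{y\sim x}\|p(x)-p(y)\|_1\le\varepsilon$. **Construction.** Let $\mathcal H$ be the graph of an irrational rotation of the circle $X=\mathbb R/\mathbb Z$ (with generators $\pm1$ of $\mathbb Z$), and let $\mu$ be Lebesgue measure on $X$. Let $T_1,T_2,\dots$ be an expander sequence of finite $3$-regular graphs with $|V(T_1)|<|V(T_2)|<\cdots$ (that is, their edge expansion constants are bounded below by some $c>0$), with vertices enumerated as $V(T_n)=\{s^n_1,\dots,s^n_{|V(T_n)|}\}$, and put $t_n=s^n_1$. Let $Y_1,Y_2,\dots\subseteq X$ be Borel sets such that for each $n$ there is $C_n$ with $d_{\mathcal H}(x,Y_n)\le C_n$ for all $x\in X$, such that $\mu(Y_n)\le 2^{-n}|V(T_n)|^{-1}$, and such that for some $D$ every point of $X$ lies in at most $D$ of the sets $Y_n$. Let $$\hat X=X\sqcup\bigsqcup_{n\ge1}\bigl(Y_n\times V(T_n)\bigr),$$ and let $\hat{\mathcal H}$ be the graph on $\hat X$ whose edges are those of $\mathcal H$, an edge joining $s$ to $(s,t_n)$ for all $n\ge 1$ and $s\in Y_n$, and a copy of $T_n$ on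 each $\{s\}\times V(T_n)$ with $s\in Y_n$. Let $\nu$ be the measure on $\hat X$ equal to $\mu$ on $X$ and to $\mu$ on each copy $Y_n\times\{v\}$ of $Y_n$, and let $\hat\mu=\nu/\nu(\hat X)$. Put $w_n(s^n_i)=2^{-i}$ for $i<|V(T_n)|$ and $w_n(s^n_{|V(T_n)|})=2^{-(|V(T_n)|-1)}$. Let $\hat\nu$ be the measure on $\hat X$ that coincides with $\hat\mu$ on $X$ and satisfies $$\hat\nu(B\times\{s^n_i\})=w_n(s^n_i)\,\hat\mu(B\times V(T_n))\qquad(n\ge1,\ 1\le i\le |V(T_n)|,\ B\subseteq Y_n\text{ Borel}).$$ **Statement.** For all such data, $(\hat{\mathcal H},\hat X,\hat\nu)$ is a measured graph of bounded vertex degrees, $\hat\nu$ and $\hat\mu$ have the same null sets, and $(\hat{\mathcal H},\hat X,\hat\nu)$ is uniformly hyperfinite, not uniformly amenable, and not of bounded type. Moreover, there exists a measured graph of bounded vertex degrees that is uniformly hyperfinite but neither uniformly amenable nor of bounded type; so the equivalence of uniform amenability and uniform hyperfiniteness for measured graphs of bounded type fails without the bounded-type hypothesis. -/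

import Mathlib

open MeasureTheory
open scoped ENNReal NNReal

noncomputable section

namespace UniformHyperfinite

/-! ### Measured graphs -/

/-- `(G, X, μ)` is a measured graph: `X` is a standard Borel space, the edge relation of `G` is a
Borel subset of `X × X`, all degrees are countable, and `μ` is a Borel probability measure that is
quasi-invariant, i.e. the union of the orbits (connected components of `G`) that meet a null set
is a null set. -/
structure IsMeasuredGraph {X : Type*} [MeasurableSpace X] (G : SimpleGraph X) (μ : Measure X) :
    Prop where
  standardBorel : StandardBorelSpace X
  borel : MeasurableSet {q : X × X | G.Adj q.1 q.2}
  countable_degree : ∀ x, (G.neighborSet x).Countable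
  prob : IsProbabilityMeasure μ
  quasiInvariant : ∀ A : Set X, MeasurableSet A → μ A = 0 → μ {x | ∃ a ∈ A, G.Reachable a x} = 0

/-- Bounded vertex degrees. -/
def HasBoundedDegree {X : Type*} (G : SimpleGraph X) : Prop :=
  ∃ d : ℕ, ∀ x, (G.neighborSet x).encard ≤ d

/-- The graph of an action of `Γ` with respect to a set `S` of group elements: distinct points are
adjacent iff an element of `S` moves one of them to the other. -/
def actionGraph (Γ : Type*) {X : Type*} [Group Γ] [MulAction Γ X] (S : Set Γ) : SimpleGraph X :=
  SimpleGraph.fromRel fun x y => ∃ σ ∈ S, y = σ • x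

/-- The Radon-Nikodym derivative `R_γ`, characterized by `μ (γ • A) = ∫_A R_γ dμ`. Note that
`A ↦ μ (γ • A)` is the push-forward of `μ` under `γ⁻¹`. -/
def radonNikodym {Γ X : Type*} [Group Γ] [MulAction Γ X] [MeasurableSpace X] (μ : Measure X)
    (γ : Γ) : X → ℝ≥0∞ :=
  (μ.map fun x => γ⁻¹ • x).rnDeriv μ

/-- Measured graphs of bounded type: the degrees are bounded, and `G` is the graph of a Borel
action of a group `Γ` with a finite symmetric generating system such that every Radon-Nikodym
derivative `R_γ` is bounded (up to a null set, as `R_γ` is only defined up to null sets). -/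
def IsBoundedType {X : Type*} [MeasurableSpace X] (G : SimpleGraph X) (μ : Measure X) : Prop :=
  HasBoundedDegree G ∧
  ∃ (Γ : Type) (_ : Group Γ) (_ : MulAction Γ X) (S : Set Γ),
    S.Finite ∧ (∀ σ ∈ S, σ⁻¹ ∈ S) ∧ Subgroup.closure S = ⊤ ∧
    (∀ γ : Γ, Measurable fun x : X => γ • x) ∧
    actionGraph Γ S = G ∧
    ∀ γ : Γ, ∃ M : ℝ≥0, ∀ᵐ x ∂μ, radonNikodym μ γ x ≤ M

/-! ### Uniform hyperfiniteness -/

/-- `(ε, K)`-hyperfiniteness: a Borel set of measure less than `ε` can be removed so that all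
components of the remaining induced graph have at most `K` vertices. -/
def IsEpsHyperfinite {X : Type*} [MeasurableSpace X] (G : SimpleGraph X) (μ : Measure X)
    (ε : ℝ) (K : ℕ) : Prop :=
  ∃ T : Set X, MeasurableSet T ∧ μ T < ENNReal.ofReal ε ∧
    ∀ c : (G.induce Tᶜ).ConnectedComponent, c.supp.encard ≤ K

/-- The normalized restriction `μ_A` of `μ` to `A`, as a measure on the subtype `A`. -/
def inducedMeasure {X : Type*} [MeasurableSpace X] (μ : Measure X) (A : Set X) : Measure A :=
  (μ A)⁻¹ • μ.comap ((↑) : A → X)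

/-- `(ε, K)`-uniform hyperfiniteness: all induced measured graphs `(G_A, A, μ_A)` on Borel sets `A`
of positive measure are `(ε, K)`-hyperfinite. -/
def IsEpsUniformlyHyperfinite {X : Type*} [MeasurableSpace X] (G : SimpleGraph X)
    (μ : Measure X) (ε : ℝ) (K : ℕ) : Prop :=
  ∀ A : Set X, MeasurableSet A → 0 < μ A →
    IsEpsHyperfinite (G.induce A) (inducedMeasure μ A) ε K

def IsUniformlyHyperfinite {X : Type*} [MeasurableSpace X] (G : SimpleGraph X)
    (μ : Measure X) : Prop :=
  ∀ ε : ℝ, 0 < ε → ∃ K : ℕ, 1 ≤ K ∧ IsEpsUniformlyHyperfinite G μ ε K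

/-! ### Uniform amenability -/

/-- The `ℓ¹`-distance of two discrete probability distributions. -/
def l1Dist {Y : Type*} (p q : PMF Y) : ℝ := ∑' z, |(p z).toReal - (q z).toReal|

/-- `(ε, R)`-uniform amenability: on an invariant Borel set `Y` of full measure there is a Borel
map `x ↦ p x` into the probability measures on `Y` such that `p x` is supported on the ball of
radius `R` around `x` and the `ℓ¹`-distances of `p x` from `p y`, `y` a neighbour of `x`, add up
to at most `ε`. -/
def IsEpsUniformlyAmenable {X : Type*} [MeasurableSpace X] (G : SimpleGraph X) (μ : Measure X)
    (ε : ℝ) (R : ℕ) : Prop :=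
  ∃ Y : Set X, MeasurableSet Y ∧ μ Yᶜ = 0 ∧ (∀ x y, x ∈ Y → G.Reachable x y → y ∈ Y) ∧
    ∃ p : Y → PMF Y,
      (∀ B : Set Y, MeasurableSet B → Measurable fun x => (p x).toMeasure B) ∧
      (∀ x z : Y, z ∈ (p x).support → G.edist x z ≤ R) ∧
      ∀ x : Y, ∑' y : {y : Y // G.Adj x y}, ENNReal.ofReal (l1Dist (p x) (p y)) ≤ ENNReal.ofReal ε

def IsUniformlyAmenable {X : Type*} [MeasurableSpace X] (G : SimpleGraph X)
    (μ : Measure X) : Prop :=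
  ∀ ε : ℝ, 0 < ε → ∃ R : ℕ, 1 ≤ R ∧ IsEpsUniformlyAmenable G μ ε R

/-! ### Expander sequences

A finite graph with a numbering of its vertices is a graph on `Fin k`. -/

/-- A sequence of finite `3`-regular (nonempty) graphs with strictly increasing numbers of vertices
whose edge expansion (Cheeger) constants are bounded away from `0`. -/
def IsCubicExpanderSequence (N : ℕ → ℕ) (T : ∀ n, SimpleGraph (Fin (N n))) : Prop :=
  StrictMono N ∧ (∀ n, 0 < N n) ∧ (∀ n v, ((T n).neighborSet v).ncard = 3) ∧
  ∃ c : ℝ, 0 < c ∧ ∀ n (S : Set (Fin (N n))), 2 * S.ncard ≤ N n →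
    c * S.ncard ≤ ({q | q.1 ∈ S ∧ q.2 ∉ S ∧ (T n).Adj q.1 q.2} : Set (_ × _)).ncard

/-! ### The rotation graph and the marker sets -/

/-- The graph of the rotation by `θ` on the circle `ℝ / ℤ` (generators `1, -1` of `ℤ`). -/
def rotationGraph (θ : ℝ) : SimpleGraph UnitAddCircle :=
  SimpleGraph.fromRel fun x y => y = x + (θ : UnitAddCircle)

/-- `Y n` are Borel sets of the circle such that every point is within a bounded distance
from `Y n` in the rotation graph, such that `Y n` has measure at most `1 / (2 ^ (n + 1) * N n)`
(indices start at `0`), and such that no point lies in more than `D` of them, for some `D`. -/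
def IsMarkerSequence (θ : ℝ) (N : ℕ → ℕ) (Y : ℕ → Set UnitAddCircle) : Prop :=
  (∀ n, MeasurableSet (Y n)) ∧
  (∀ n, ∃ C : ℕ, ∀ x, ∃ y ∈ Y n, (rotationGraph θ).edist x y ≤ C) ∧
  (∀ n, volume (Y n) ≤ ENNReal.ofReal (1 / (2 ^ (n + 1) * N n))) ∧
  ∃ D : ℕ, ∀ x, {n | x ∈ Y n}.encard ≤ D

/-! ### The rotation graph with expanders attached -/

/-- The disjoint union of the circle and of the sets `Y n × V (T n)`. -/
abbrev Xhat (N : ℕ → ℕ) (Y : ℕ → Set UnitAddCircle) : Type :=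
  UnitAddCircle ⊕ (Σ n, Y n × Fin (N n))

/-- The oriented edges: those of the rotation graph, those joining `s ∈ Y n` to `(s, t)` for the
first vertex `t` of `T n`, and a copy of `T n` on each `{s} × V (T n)`. -/
inductive HhatAdj (θ : ℝ) {N : ℕ → ℕ} (T : ∀ n, SimpleGraph (Fin (N n)))
    (Y : ℕ → Set UnitAddCircle) : Xhat N Y → Xhat N Y → Prop
  | base (x y : UnitAddCircle) (h : (rotationGraph θ).Adj x y) :
      HhatAdj θ T Y (.inl x) (.inl y)
  | up (n : ℕ) (s : Y n) (t : Fin (N n)) (h : t.val = 0) :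
      HhatAdj θ T Y (.inl s) (.inr ⟨n, s, t⟩)
  | down (n : ℕ) (s : Y n) (t : Fin (N n)) (h : t.val = 0) :
      HhatAdj θ T Y (.inr ⟨n, s, t⟩) (.inl s)
  | fiber (n : ℕ) (s : Y n) (i j : Fin (N n)) (h : (T n).Adj i j) :
      HhatAdj θ T Y (.inr ⟨n, s, i⟩) (.inr ⟨n, s, j⟩)

def Hhat (θ : ℝ) {N : ℕ → ℕ} (T : ∀ n, SimpleGraph (Fin (N n)))
    (Y : ℕ → Set UnitAddCircle) : SimpleGraph (Xhat N Y) where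
  Adj := HhatAdj θ T Y
  symm := ⟨fun _ _ h => by
    cases h with
    | base x y h => exact .base y x h.symm
    | up n s t h => exact .down n s t h
    | down n s t h => exact .up n s t h
    | fiber n s i j h => exact .fiber n s j i h.symm⟩
  loopless := ⟨fun _ h => by
    cases h with
    | base x _ h => exact h.ne rfl
    | fiber n s i _ h => exact h.ne rfl⟩

/-- The measure on `Xhat N Y` which is Lebesgue measure on the circle and `c n i` times Lebesgue
measure on the copy `Y n × {i}` of `Y n`. -/
def copyMeasure {N : ℕ → ℕ} (Y : ℕ → Set UnitAddCircle) (c : ∀ n, Fin (N n) → ℝ≥0∞) :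
    Measure (Xhat N Y) :=
  (volume : Measure UnitAddCircle).map Sum.inl +
    Measure.sum fun n => ∑ i : Fin (N n),
      c n i • ((volume : Measure UnitAddCircle).comap ((↑) : Y n → UnitAddCircle)).map
        fun s => (Sum.inr ⟨n, s, i⟩ : Xhat N Y)

/-- The measure `ν`: Lebesgue measure on the circle and on each copy of each `Y n`. -/
def nu (N : ℕ → ℕ) (Y : ℕ → Set UnitAddCircle) : Measure (Xhat N Y) :=
  copyMeasure Y fun _ _ => 1

/-- `μ̂`, the normalization of `ν`. -/
def muHat (N : ℕ → ℕ) (Y : ℕ → Set UnitAddCircle) : Measure (Xhat N Y) :=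
  (nu N Y Set.univ)⁻¹ • nu N Y

/-- The weights `1/2, 1/4, …, 1/2^(k-2), 1/2^(k-1), 1/2^(k-1)` of the vertices `0, 1, …, k - 1`. -/
def weight {k : ℕ} (i : Fin k) : ℝ≥0∞ :=
  if i.val + 1 = k then 2⁻¹ ^ (k - 1) else 2⁻¹ ^ (i.val + 1)

/-- `ν̂`: it agrees with `μ̂` on the circle, and
`ν̂ (B × {i}) = weight i * μ̂ (B × V (T n)) = weight i * N n * (ν univ)⁻¹ * volume B`
for Borel sets `B ⊆ Y n` and `i ∈ V (T n)`. -/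
def nuHat (N : ℕ → ℕ) (Y : ℕ → Set UnitAddCircle) : Measure (Xhat N Y) :=
  (nu N Y Set.univ)⁻¹ • copyMeasure Y fun n i => weight i * N n

end UniformHyperfinite

end

namespace UniformHyperfinite

/-! ### Counting subsets and permutations -/

/-! The measure `nuHat` has the null sets of `muHat`, but its weights decay geometrically along the
numbering of each attached expander; the numbering ignores the graph structure.

Uniform hyperfiniteness: on the circle, one of `2 ^ m` disjoint translates of an arc carries at most
the fraction `2⁻¹ ^ m` of the part of `A` in the circle; removing it cuts the orbits into segments
of length bounded independently of `A` (`exists_small_cut`). In each attached graph, the vertices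
numbered more than `m` beyond some vertex of `A` weigh at most `2⁻¹ ^ m` times the part of `A`
there, and removing them leaves at most `m + 1` points of `A` (`copyMeasure_inter_cutSet_le`,
`encard_fibre_diff_cutSet_le`).

Uniform amenability only sees null sets, and an invariant set of full measure contains whole copies
of arbitrarily large expanders. Distributions supported on balls of radius `R` spread each target
point over boundedly many vertices, so the co-area inequality bounds their average variation below
(`mul_card_le_sum_l1Dist`).

Bounded type: bounded Radon-Nikodym derivatives of the finitely many generators would bound the
weight ratio of adjacent vertices, hence the difference of their numbers. The first half of the
vertices would then have bounded edge boundary, against expansion.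

For the existence claim, cubic expanders come from a random perfect matching between two cycles
(`exists_twistedPrism_expander`), and the marker sets are disjoint thin annuli around `0`
(`exists_isMarkerSequence`). -/

open Finset in
/-- The permutations mapping `A` onto a given set make up at most a fraction
`1 / (n choose #A)` of all permutations. -/
theorem card_perm_map_eq_mul_choose_le {α : Type*} [Fintype α] [DecidableEq α] (A W : Finset α) :
    #{π : Equiv.Perm α | A.map π.toEmbedding = W} * (Fintype.card α).choose #A ≤
      (Fintype.card α).factorial := by
  by_cases hW : #W = #A
  -- Left multiplication by a permutation taking `W` to `W'` injects one fibre of `π ↦ A.map π` into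
  -- another, and the fibres over all sets of size `#A` partition the group.
  · have key : ∀ W' ∈ powersetCard #A (univ : Finset α),
        #{π : Equiv.Perm α | A.map π.toEmbedding = W} ≤
          #{π : Equiv.Perm α | A.map π.toEmbedding = W'} := by
      intro W' hW'
      have hc : #W = #W' := hW.trans (mem_powersetCard.1 hW').2.symm
      let e : {x // x ∈ W} ≃ {x // x ∈ W'} := Finset.equivOfCardEq hc
      let σ : Equiv.Perm α := e.extendSubtype
      have hσ : W.map σ.toEmbedding = W' := by
        apply eq_of_subset_of_card_le
        · intro x hx
          obtain ⟨y, hy, rfl⟩ := mem_map.1 hx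
          exact e.extendSubtype_mem y hy
        · rw [card_map, hc]
      refine card_le_card_of_injOn (fun π => σ * π) ?_ (fun π _ π' _ h => mul_left_cancel h)
      intro π hπ
      simp only [coe_filter, mem_univ, true_and, Set.mem_ofPred_eq] at hπ ⊢
      rw [← hσ, ← hπ, map_map]
      rfl
    have hsum : ∑ W' ∈ powersetCard #A (univ : Finset α),
        #{π : Equiv.Perm α | A.map π.toEmbedding = W'} = (Fintype.card α).factorial := by
      rw [← Fintype.card_perm, ← Finset.card_univ]
      refine (card_eq_sum_card_fiberwise fun π _ => ?_).symm
      simp [mem_powersetCard]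
    calc _ = ∑ W' ∈ powersetCard #A (univ : Finset α),
          #{π : Equiv.Perm α | A.map π.toEmbedding = W} := by
            rw [sum_const, card_powersetCard, smul_eq_mul, mul_comm, Finset.card_univ]
      _ ≤ _ := sum_le_sum key
      _ = _ := hsum
  · have : ({π : Equiv.Perm α | A.map π.toEmbedding = W} : Finset _) = ∅ := by
      ext π
      simp only [mem_filter, mem_univ, true_and, notMem_empty, iff_false]
      rintro rfl
      exact hW (card_map _)
    simp [this]

/-- Binomial coefficients increase up to the middle; an index beyond the middle is reflected. -/
theorem choose_le_choose_of_le_of_add_le {m r a : ℕ} (h : r ≤ a) (h' : a + r ≤ m) :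
    m.choose r ≤ m.choose a := by
  have key : ∀ b, r ≤ b → b ≤ m / 2 → m.choose r ≤ m.choose b := by
    intro b hb
    induction b, hb using Nat.le_induction with
    | base => intro _; exact le_rfl
    | succ b hb ih =>
      intro h
      exact (ih (by omega)).trans (Nat.choose_le_succ_of_lt_half_left (by omega))
  by_cases ha : a ≤ m / 2
  · exact key a h ha
  · rw [← Nat.choose_symm (show a ≤ m by omega)]
    exact key _ (by omega) (by omega)

open Finset in
/-- There are at most `(3 m / k) ^ k` subsets of size at most `k` of a set of size `m`. -/
theorem card_filter_card_le_le {α : Type*} [Fintype α] [DecidableEq α] {k : ℕ} (hk : 1 ≤ k)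
    (hkm : k ≤ Fintype.card α) :
    (#{E : Finset α | #E ≤ k} : ℝ) ≤ (3 * Fintype.card α / k) ^ k := by
  set m := Fintype.card α
  have hk0 : (0 : ℝ) < k := by exact_mod_cast hk
  have h1 : #{E : Finset α | #E ≤ k} ≤ ∑ j ∈ range (k + 1), m.choose j := by
    calc #{E : Finset α | #E ≤ k}
        ≤ #((range (k + 1)).biUnion fun j => powersetCard j (univ : Finset α)) := by
          apply card_le_card
          intro E hE
          simp only [mem_filter, mem_univ, true_and] at hE
          simp only [mem_biUnion, mem_range, mem_powersetCard]
          exact ⟨#E, by omega, subset_univ _, rfl⟩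
      _ ≤ _ := card_biUnion_le
      _ = _ := by simp [m]
  -- As `m / k ≥ 1`, the powers `(m / k) ^ j` are at most `(m / k) ^ k`; the rest is a partial sum
  -- of the series of `exp k ≤ 3 ^ k`.
  have hmk : (1 : ℝ) ≤ m / k := by
    rw [le_div_iff₀ hk0, one_mul]; exact_mod_cast hkm
  calc (#{E : Finset α | #E ≤ k} : ℝ) ≤ ∑ j ∈ range (k + 1), (m.choose j : ℝ) := by
        exact_mod_cast h1
    _ ≤ ∑ j ∈ range (k + 1), (m / k : ℝ) ^ k * ((k : ℝ) ^ j / j.factorial) := by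
        apply sum_le_sum
        intro j hj
        calc (m.choose j : ℝ) ≤ (m : ℝ) ^ j / j.factorial := Nat.choose_le_pow_div j m
          _ = (m / k : ℝ) ^ j * ((k : ℝ) ^ j / j.factorial) := by
            rw [div_pow]; field_simp
          _ ≤ _ := by
            gcongr
            exact Nat.lt_succ_iff.1 (mem_range.1 hj)
    _ = (m / k : ℝ) ^ k * ∑ j ∈ range (k + 1), ((k : ℝ) ^ j / j.factorial) := by
        rw [mul_sum]
    _ ≤ (m / k : ℝ) ^ k * Real.exp k := by
        gcongr
        exact Real.sum_le_exp_of_nonneg hk0.le _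
    _ ≤ (m / k : ℝ) ^ k * 3 ^ k := by
        gcongr
        rw [← mul_one (k : ℝ), Real.exp_nat_mul]
        gcongr
        exact (Real.exp_one_lt_d9.le.trans (by norm_num))
    _ = _ := by rw [← mul_pow]; ring_nf

/-- A numerical estimate: the number of pairs of sets with small boundary, times the number of
small perturbations, is small compared to a binomial coefficient. -/
theorem triple_count_le_choose {m k : ℕ} (hk : 1 ≤ k) (hkm : 80 * k ≤ m) :
    4 * 2 ^ k * ((3 * m / k : ℝ) ^ k) ^ 3 ≤ m.choose (20 * k) := by
  have hk0 : (0 : ℝ) < k := by exact_mod_cast hk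
  have hkm' : (80 * k : ℝ) ≤ m := by exact_mod_cast hkm
  set y : ℝ := m / (80 * k) with hy
  have hy1 : 1 ≤ y := by rw [hy, le_div_iff₀ (by positivity)]; linarith
  have hm : (m : ℝ) = 80 * k * y := by rw [hy]; field_simp
  -- From `(m + 1 - r) ^ r / r! ≤ m.choose r` with `r = 20 k`, since `r! ≤ r ^ r` and `m - 20 k ≥ 60
  -- k y`.
  have h1 : (3 * y) ^ (20 * k) ≤ (m.choose (20 * k) : ℝ) := by
    refine le_trans ?_ (Nat.pow_le_choose (α := ℝ) (20 * k) m)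
    have hf : ((20 * k).factorial : ℝ) ≤ (20 * k : ℝ) ^ (20 * k) := by
      exact_mod_cast Nat.factorial_le_pow (20 * k)
    have h2 : ((m + 1 - 20 * k : ℕ) : ℝ) = m + 1 - 20 * k := by
      rw [Nat.cast_sub (by omega)]; push_cast; ring
    rw [le_div_iff₀ (by positivity)]
    calc (3 * y) ^ (20 * k) * (20 * k).factorial
        ≤ (3 * y) ^ (20 * k) * (20 * k : ℝ) ^ (20 * k) := by gcongr
      _ = (60 * k * y) ^ (20 * k) := by rw [← mul_pow]; ring_nf
      _ ≤ _ := by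
        rw [h2, hm]
        gcongr
        nlinarith
  have h3 : 3 * (m : ℝ) / k = 240 * y := by rw [hm]; field_simp; ring
  calc 4 * 2 ^ k * ((3 * m / k : ℝ) ^ k) ^ 3
      ≤ 4 ^ k * 2 ^ k * ((240 * y) ^ k) ^ 3 := by
        rw [h3]
        gcongr
        exact le_self_pow₀ (by norm_num) (by omega)
    _ = (8 * (240 * y) ^ 3) ^ k := by
        rw [mul_pow 8, ← pow_mul, ← pow_mul, mul_comm k 3, ← mul_pow]; norm_num
    -- The choice of `20` is settled here: `8 * 240 ^ 3 ≤ 3 ^ 20`, and `y ≥ 1` absorbs the higher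
    -- power.
    _ ≤ ((3 * y) ^ 20) ^ k := by
        gcongr
        have : y ^ 3 ≤ y ^ 20 := pow_le_pow_right₀ hy1 (by norm_num)
        have h0 : 0 ≤ y ^ 3 := by positivity
        rw [mul_pow, mul_pow]
        norm_num
        nlinarith
    _ = (3 * y) ^ (20 * k) := by rw [← pow_mul]
    _ ≤ _ := h1

/-! ### Boundaries in a cycle -/

/-- The edges `{i, i + 1}` of the cycle that have exactly one end in `A`. -/
def cycleBoundary {m : ℕ} [NeZero m] (A : Finset (ZMod m)) : Finset (ZMod m) :=
  {i | ¬ (i ∈ A ↔ i + 1 ∈ A)}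

/-- Walking around the cycle from `0`, membership flips exactly at the boundary edges. -/
theorem mem_iff_of_cycleBoundary_eq {m : ℕ} [NeZero m] {A A' : Finset (ZMod m)}
    (h : cycleBoundary A = cycleBoundary A') (h0 : 0 ∈ A ↔ 0 ∈ A') (i : ZMod m) :
    i ∈ A ↔ i ∈ A' := by
  have key : ∀ n : ℕ, ((n : ZMod m) ∈ A ↔ (n : ZMod m) ∈ A') := by
    intro n
    induction n with
    | zero => simpa using h0
    | succ n ih =>
      have := Finset.ext_iff.1 h n
      simp only [cycleBoundary, Finset.mem_filter, Finset.mem_univ, true_and] at this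
      push_cast
      tauto
  obtain ⟨n, rfl⟩ := ZMod.natCast_zmod_surjective i
  exact key n

open Finset in
theorem card_cycleBoundary_le_le {m : ℕ} [NeZero m] (k : ℕ) :
    #{A : Finset (ZMod m) | #(cycleBoundary A) ≤ k} ≤ 2 * #{E : Finset (ZMod m) | #E ≤ k} := by
  calc _ ≤ #((univ : Finset Bool) ×ˢ ({E : Finset (ZMod m) | #E ≤ k} : Finset _)) := by
        refine card_le_card_of_injOn (fun A => (decide (0 ∈ A), cycleBoundary A)) ?_ ?_
        · intro A hA
          simp only [coe_filter, mem_univ, true_and, Set.mem_ofPred_eq] at hA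
          simp [hA, em]
        · intro A _ A' _ h
          simp only [Prod.mk.injEq, decide_eq_decide] at h
          ext i
          exact mem_iff_of_cycleBoundary_eq h.2 h.1 i
    _ = _ := by rw [card_product]; rfl

theorem eq_empty_or_univ_of_cycleBoundary_eq_empty {m : ℕ} [NeZero m] {A : Finset (ZMod m)}
    (h : cycleBoundary A = ∅) : A = ∅ ∨ A = Finset.univ := by
  by_cases h0 : 0 ∈ A
  · right
    ext i
    exact mem_iff_of_cycleBoundary_eq (h.trans (by simp [cycleBoundary])) (by simpa using h0) i
  · left
    ext i
    exact mem_iff_of_cycleBoundary_eq (h.trans (by simp [cycleBoundary])) (by simpa using h0) i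

/-! ### Good matchings of two cycles -/

open Finset in
/-- The permutations for which some pair of large sets has boundary of order `k`. -/
def badPerms (m : ℕ) [NeZero m] (k : ℕ) : Finset (Equiv.Perm (ZMod m)) :=
  {π | ∃ A B : Finset (ZMod m), #(cycleBoundary A) ≤ k ∧ #(cycleBoundary B) ≤ k ∧
    #(symmDiff (A.map π.toEmbedding) B) ≤ k ∧ 20 * k ≤ #A ∧ #A + 20 * k ≤ m}

-- Union bound: the image of `A` is determined by `B` and the symmetric difference, so a bad
-- permutation lies in one of at most `4 * #P ^ 3` fibres, each of size at most `m! / m.choose (20 *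
-- k)`.
open Finset in
theorem card_badPerms_le {m : ℕ} [NeZero m] {k : ℕ} (hk : 1 ≤ k) (hkm : 80 * k ≤ m) :
    #(badPerms m k) * 2 ^ k ≤ m.factorial := by
  set Q : Finset (Finset (ZMod m)) := {A | #(cycleBoundary A) ≤ k}
  set P : Finset (Finset (ZMod m)) := {E | #E ≤ k}
  set Q' : Finset (Finset (ZMod m)) := {A ∈ Q | 20 * k ≤ #A ∧ #A + 20 * k ≤ m}
  have hsub : badPerms m k ⊆ (Q' ×ˢ (Q ×ˢ P)).biUnion fun t =>
      {π : Equiv.Perm (ZMod m) | t.1.map π.toEmbedding = symmDiff t.2.2 t.2.1} := by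
    intro π hπ
    simp only [badPerms, mem_filter, mem_univ, true_and] at hπ
    obtain ⟨A, B, hA, hB, hAB, h1, h2⟩ := hπ
    simp only [mem_biUnion, mem_product, mem_filter, mem_univ, true_and, Prod.exists]
    refine ⟨A, B, symmDiff (A.map π.toEmbedding) B, ⟨?_, ?_, ?_⟩, ?_⟩
    · simp [Q', Q, hA, h1, h2]
    · simp [Q, hB]
    · simp [P, hAB]
    · rw [symmDiff_assoc, symmDiff_self, symmDiff_bot]
  have hcard : #(badPerms m k) * m.choose (20 * k) ≤ #Q' * (#Q * #P) * m.factorial := by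
    calc _ ≤ (∑ t ∈ Q' ×ˢ (Q ×ˢ P),
          #{π : Equiv.Perm (ZMod m) | t.1.map π.toEmbedding = symmDiff t.2.2 t.2.1}) *
            m.choose (20 * k) := by
          gcongr
          exact (card_le_card hsub).trans card_biUnion_le
      _ ≤ ∑ t ∈ Q' ×ˢ (Q ×ˢ P), m.factorial := by
          rw [sum_mul]
          apply sum_le_sum
          intro t ht
          have ht' := (mem_filter.1 (mem_product.1 ht).1).2
          calc _ ≤ _ := Nat.mul_le_mul_left _ (choose_le_choose_of_le_of_add_le ht'.1 ht'.2)
            _ ≤ m.factorial := by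
              simpa [ZMod.card] using card_perm_map_eq_mul_choose_le t.1 (symmDiff t.2.2 t.2.1)
      _ = _ := by simp [card_product]
  have hQ : #Q ≤ 2 * #P := card_cycleBoundary_le_le k
  have hQ' : #Q' ≤ 2 * #P := (card_le_card (filter_subset _ _)).trans hQ
  have hP : (#P : ℝ) ≤ (3 * m / k) ^ k := by
    have := card_filter_card_le_le (α := ZMod m) hk (by rw [ZMod.card]; omega)
    simpa [ZMod.card] using this
  have hnum := triple_count_le_choose hk hkm
  have hpos : (0 : ℝ) < m.choose (20 * k) := by
    exact_mod_cast Nat.choose_pos (by omega)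
  have hreal : (#(badPerms m k) * 2 ^ k : ℝ) * m.choose (20 * k) ≤
      m.factorial * m.choose (20 * k) := by
    calc (#(badPerms m k) * 2 ^ k : ℝ) * m.choose (20 * k)
        = 2 ^ k * (#(badPerms m k) * m.choose (20 * k) : ℕ) := by push_cast; ring
      _ ≤ 2 ^ k * (#Q' * (#Q * #P) * m.factorial : ℕ) := by gcongr
      _ ≤ 2 ^ k * (2 * #P * (2 * #P * #P) * m.factorial : ℕ) := by gcongr
      _ = (4 * 2 ^ k * (#P : ℝ) ^ 3) * m.factorial := by push_cast; ring
      _ ≤ (4 * 2 ^ k * ((3 * m / k : ℝ) ^ k) ^ 3) * m.factorial := by gcongr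
      _ ≤ _ := by rw [mul_comm (m.factorial : ℝ)]; gcongr
  exact_mod_cast le_of_mul_le_mul_right hreal hpos

-- The bad permutations of order `k` make up a fraction of at most `2⁻ᵏ`, and these fractions sum to
-- less than `1`.
open Finset in
theorem exists_perm_forall_notMem_badPerms (m : ℕ) [NeZero m] :
    ∃ π : Equiv.Perm (ZMod m), ∀ k, 1 ≤ k → 80 * k ≤ m → π ∉ badPerms m k := by
  by_contra! hcon
  have hsub : (univ : Finset (Equiv.Perm (ZMod m))) ⊆
      ((Ico 1 (m + 1)).filter fun k => 80 * k ≤ m).biUnion (badPerms m) := by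
    intro π _
    obtain ⟨k, h1, h2, h3⟩ := hcon π
    simp only [mem_biUnion, mem_filter, mem_Ico]
    exact ⟨k, ⟨⟨h1, by omega⟩, h2⟩, h3⟩
  have h1 : m.factorial ≤ ∑ k ∈ (Ico 1 (m + 1)).filter fun k => 80 * k ≤ m, #(badPerms m k) := by
    have := (card_le_card hsub).trans card_biUnion_le
    simpa [Fintype.card_perm, ZMod.card] using this
  have hF : (0 : ℝ) < m.factorial := by exact_mod_cast m.factorial_pos
  have h2 : (m.factorial : ℝ) ≤ m.factorial * ∑ k ∈ Ico 1 (m + 1), (1 / 2 : ℝ) ^ k := by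
    calc (m.factorial : ℝ)
        ≤ ∑ k ∈ (Ico 1 (m + 1)).filter fun k => 80 * k ≤ m, (#(badPerms m k) : ℝ) := by
          exact_mod_cast h1
      _ ≤ ∑ k ∈ (Ico 1 (m + 1)).filter fun k => 80 * k ≤ m, m.factorial * (1 / 2 : ℝ) ^ k := by
          apply sum_le_sum
          intro k hk
          simp only [mem_filter, mem_Ico] at hk
          have : (#(badPerms m k) * 2 ^ k : ℝ) ≤ m.factorial := by
            exact_mod_cast card_badPerms_le hk.1.1 hk.2
          rw [one_div, inv_pow, ← div_eq_mul_inv, le_div_iff₀ (by positivity)]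
          exact this
      _ ≤ ∑ k ∈ Ico 1 (m + 1), m.factorial * (1 / 2 : ℝ) ^ k :=
          sum_le_sum_of_subset_of_nonneg (filter_subset _ _) fun _ _ _ => by positivity
      _ = _ := by rw [mul_sum]
  have h3 : ∑ k ∈ Ico 1 (m + 1), (1 / 2 : ℝ) ^ k < 1 := by
    have : ∀ n : ℕ, ∑ k ∈ Ico 1 (n + 1), (1 / 2 : ℝ) ^ k = 1 - (1 / 2) ^ n := by
      intro n
      induction n with
      | zero => simp
      | succ n ih => rw [sum_Ico_succ_top (by omega), ih, pow_succ]; ring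
    rw [this]
    have : (0 : ℝ) < (1 / 2) ^ m := by positivity
    linarith
  nlinarith

open Finset in
/-- For a good permutation, pairs of sets of total size at most `m` have large boundary. -/
theorem exists_perm_boundary (m : ℕ) [NeZero m] : ∃ π : Equiv.Perm (ZMod m),
    ∀ A B : Finset (ZMod m), #A + #B ≤ m →
      #A + #B ≤ 100 * (#(cycleBoundary A) + #(cycleBoundary B) +
        #(symmDiff (A.map π.toEmbedding) B)) := by
  obtain ⟨π, hπ⟩ := exists_perm_forall_notMem_badPerms m
  refine ⟨π, fun A B hAB => ?_⟩
  by_contra! hlt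
  set k := #(cycleBoundary A) + #(cycleBoundary B) + #(symmDiff (A.map π.toEmbedding) B)
    with hkdef
  have hm : 0 < m := Nat.pos_of_ne_zero (NeZero.ne m)
  have hd1 : #(A.map π.toEmbedding) ≤ #B + #(symmDiff (A.map π.toEmbedding) B) := by
    refine (card_le_card ?_).trans (card_union_le _ _)
    intro x hx
    by_cases hB : x ∈ B
    · exact mem_union_left _ hB
    · exact mem_union_right _ (mem_symmDiff.2 (Or.inl ⟨hx, hB⟩))
  have hd2 : #B ≤ #(A.map π.toEmbedding) + #(symmDiff (A.map π.toEmbedding) B) := by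
    refine (card_le_card ?_).trans (card_union_le _ _)
    intro x hx
    by_cases hB : x ∈ A.map π.toEmbedding
    · exact mem_union_left _ hB
    · exact mem_union_right _ (mem_symmDiff.2 (Or.inr ⟨hx, hB⟩))
  rw [card_map] at hd1 hd2
  by_cases hk : k = 0
  · have hA : cycleBoundary A = ∅ := card_eq_zero.1 (by omega)
    have hcA : #A = #B := by omega
    rcases eq_empty_or_univ_of_cycleBoundary_eq_empty hA with h | h
    · rw [h, card_empty] at hcA hlt
      omega
    · have : #A = m := by rw [h, Finset.card_univ, ZMod.card]
      omega
  -- The sizes of `A` and `B` differ by at most `k` and their sum lies between `100 k` and `m`, so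
  -- `#A` is at least `20 k` and at most `m - 20 k`.
  · refine hπ k (by omega) (by omega) ?_
    simp only [badPerms, mem_filter, mem_univ, true_and]
    exact ⟨A, B, by omega, by omega, by omega, by omega, by omega⟩

/-! ### Cubic expanders -/

/-- Two cycles of length `m`, joined by the perfect matching given by `π`. -/
def twistedPrism {m : ℕ} (π : Equiv.Perm (ZMod m)) : SimpleGraph (ZMod m ⊕ ZMod m) :=
  SimpleGraph.fromRel fun x y =>
    (∃ i, x = .inl i ∧ y = .inl (i + 1)) ∨ (∃ i, x = .inr i ∧ y = .inr (i + 1)) ∨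
      ∃ i, x = .inl i ∧ y = .inr (π i)

theorem zmod_add_one_ne {m : ℕ} (hm : 3 ≤ m) (i : ZMod m) : i ≠ i + 1 := by
  have : Fact (1 < m) := ⟨by omega⟩
  simp

theorem zmod_add_one_ne_sub_one {m : ℕ} (hm : 3 ≤ m) (i : ZMod m) : i + 1 ≠ i - 1 := by
  intro h
  have h2 : ((2 : ℕ) : ZMod m) = 0 := by
    have : (2 : ZMod m) = (i + 1) - (i - 1) := by ring
    push_cast
    rw [this, h, sub_self]
  rw [ZMod.natCast_eq_zero_iff] at h2
  exact absurd (Nat.le_of_dvd (by norm_num) h2) (by omega)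

theorem twistedPrism_adj_inl {m : ℕ} (hm : 3 ≤ m) (π : Equiv.Perm (ZMod m)) (i : ZMod m) :
    (twistedPrism π).neighborSet (.inl i) =
      ((({.inl (i + 1), .inl (i - 1), .inr (π i)} : Finset (ZMod m ⊕ ZMod m))) : Set _) := by
  have h1 := zmod_add_one_ne hm
  ext y
  simp only [SimpleGraph.mem_neighborSet, twistedPrism, SimpleGraph.fromRel_adj, Finset.coe_insert,
    Finset.coe_singleton, Set.mem_insert_iff, Set.mem_singleton_iff]
  rcases y with j | j
  · simp only [ne_eq, Sum.inl.injEq, reduceCtorEq, and_false, exists_false, or_false,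
      exists_eq_left']
    constructor
    · rintro ⟨h, rfl | h⟩
      · exact Or.inl rfl
      · exact Or.inr (by rw [h, add_sub_cancel_right])
    · rintro (rfl | rfl)
      · exact ⟨h1 i, Or.inl rfl⟩
      · exact ⟨fun h => h1 i (eq_add_of_sub_eq h.symm), Or.inr (sub_add_cancel _ _).symm⟩
  · simp

theorem twistedPrism_adj_inr {m : ℕ} (hm : 3 ≤ m) (π : Equiv.Perm (ZMod m)) (i : ZMod m) :
    (twistedPrism π).neighborSet (.inr i) =
      ((({.inr (i + 1), .inr (i - 1), .inl (π.symm i)} : Finset (ZMod m ⊕ ZMod m))) : Set _) := by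
  have h1 := zmod_add_one_ne hm
  ext y
  simp only [SimpleGraph.mem_neighborSet, twistedPrism, SimpleGraph.fromRel_adj, Finset.coe_insert,
    Finset.coe_singleton, Set.mem_insert_iff, Set.mem_singleton_iff]
  rcases y with j | j
  · simp [Equiv.eq_symm_apply, eq_comm]
  · simp only [ne_eq, Sum.inr.injEq, reduceCtorEq, false_and, and_false, exists_false, or_false,
      exists_eq_left', false_or]
    constructor
    · rintro ⟨h, rfl | h⟩
      · exact Or.inl rfl
      · exact Or.inr (by rw [h, add_sub_cancel_right])
    · rintro (rfl | rfl)
      · exact ⟨h1 i, Or.inl rfl⟩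
      · exact ⟨fun h => h1 i (eq_add_of_sub_eq h.symm), Or.inr (sub_add_cancel _ _).symm⟩

theorem twistedPrism_ncard_neighborSet {m : ℕ} (hm : 3 ≤ m) (π : Equiv.Perm (ZMod m))
    (v : ZMod m ⊕ ZMod m) : ((twistedPrism π).neighborSet v).ncard = 3 := by
  have h2 := zmod_add_one_ne_sub_one hm
  rcases v with i | i
  · rw [twistedPrism_adj_inl hm, Set.ncard_coe_finset, Finset.card_eq_three]
    exact ⟨_, _, _, by simpa using h2 i, by simp, by simp, rfl⟩
  · rw [twistedPrism_adj_inr hm, Set.ncard_coe_finset, Finset.card_eq_three]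
    exact ⟨_, _, _, by simpa using h2 i, by simp, by simp, rfl⟩

/-- The ordered pairs of adjacent vertices that leave `S`. -/
def edgeBoundary {V : Type*} (G : SimpleGraph V) (S : Set V) : Set (V × V) :=
  {q | q.1 ∈ S ∧ q.2 ∉ S ∧ G.Adj q.1 q.2}

open Finset in
theorem card_le_ncard_edgeBoundary {ι V : Type*} [Finite V] {G : SimpleGraph V} {S : Set V}
    (E : Finset ι) (f : ι → V × V) (hf : Function.Injective f)
    (h : ∀ i ∈ E, f i ∈ edgeBoundary G S) : #E ≤ (edgeBoundary G S).ncard := by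
  classical
  rw [← card_image_of_injective E hf, ← Set.ncard_coe_finset]
  apply Set.ncard_le_ncard _ (Set.toFinite _)
  intro x hx
  obtain ⟨i, hi, rfl⟩ := mem_image.1 (mem_coe.1 hx)
  exact h i hi

-- With `A` and `B` the traces of `S` on the two cycles, the three quantities of
-- `exists_perm_boundary` count the cut edges of either cycle and of the matching. Splitting each by
-- the direction in which the edge leaves `S` bounds it by `2 b`, whence `600 = 100 * 6`.
open Finset in
theorem exists_twistedPrism_expander {m : ℕ} (hm : 3 ≤ m) : ∃ π : Equiv.Perm (ZMod m),
    ∀ S : Set (ZMod m ⊕ ZMod m), 2 * S.ncard ≤ 2 * m →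
      S.ncard ≤ 600 * (edgeBoundary (twistedPrism π) S).ncard := by
  classical
  have : NeZero m := ⟨by omega⟩
  obtain ⟨π, hπ⟩ := exists_perm_boundary m
  refine ⟨π, fun S hS => ?_⟩
  have adj : ∀ v w, w ∈ (twistedPrism π).neighborSet v → (twistedPrism π).Adj v w := fun _ _ h => h
  have adj1 : ∀ i, (twistedPrism π).Adj (.inl i) (.inl (i + 1)) := fun i =>
    adj _ _ (by rw [twistedPrism_adj_inl hm]; simp)
  have adj2 : ∀ i, (twistedPrism π).Adj (.inr i) (.inr (i + 1)) := fun i =>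
    adj _ _ (by rw [twistedPrism_adj_inr hm]; simp)
  have adj3 : ∀ i, (twistedPrism π).Adj (.inl i) (.inr (π i)) := fun i =>
    adj _ _ (by rw [twistedPrism_adj_inl hm]; simp)
  set A : Finset (ZMod m) := {i | .inl i ∈ S}
  set B : Finset (ZMod m) := {i | .inr i ∈ S}
  have hSc : S.ncard = #A + #B := by
    have : S = ((A.disjSum B : Finset _) : Set _) := by
      ext x
      rcases x with i | i <;> simp [A, B]
    rw [this, Set.ncard_coe_finset, card_disjSum]
  set b := (edgeBoundary (twistedPrism π) S).ncard
  have e1 : #(cycleBoundary A) ≤ b + b := by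
    have : cycleBoundary A ⊆ ({i | i ∈ A ∧ i + 1 ∉ A} : Finset _) ∪
        ({i | i ∉ A ∧ i + 1 ∈ A} : Finset _) := by
      intro i hi
      simp only [cycleBoundary, mem_filter, mem_univ, true_and, mem_union] at hi ⊢
      tauto
    refine ((card_le_card this).trans (card_union_le _ _)).trans (add_le_add ?_ ?_)
    · refine card_le_ncard_edgeBoundary _ (fun i => (.inl i, .inl (i + 1))) ?_ ?_
      · intro i j h; simpa using (Prod.ext_iff.1 h).1
      · intro i hi
        simp only [mem_filter, mem_univ, true_and, A] at hi
        exact ⟨hi.1, hi.2, adj1 i⟩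
    · refine card_le_ncard_edgeBoundary _ (fun i => (.inl (i + 1), .inl i)) ?_ ?_
      · intro i j h; simpa using (Prod.ext_iff.1 h).1
      · intro i hi
        simp only [mem_filter, mem_univ, true_and, A] at hi
        exact ⟨hi.2, hi.1, (adj1 i).symm⟩
  have e2 : #(cycleBoundary B) ≤ b + b := by
    have : cycleBoundary B ⊆ ({i | i ∈ B ∧ i + 1 ∉ B} : Finset _) ∪
        ({i | i ∉ B ∧ i + 1 ∈ B} : Finset _) := by
      intro i hi
      simp only [cycleBoundary, mem_filter, mem_univ, true_and, mem_union] at hi ⊢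
      tauto
    refine ((card_le_card this).trans (card_union_le _ _)).trans (add_le_add ?_ ?_)
    · refine card_le_ncard_edgeBoundary _ (fun i => (.inr i, .inr (i + 1))) ?_ ?_
      · intro i j h; simpa using (Prod.ext_iff.1 h).1
      · intro i hi
        simp only [mem_filter, mem_univ, true_and, B] at hi
        exact ⟨hi.1, hi.2, adj2 i⟩
    · refine card_le_ncard_edgeBoundary _ (fun i => (.inr (i + 1), .inr i)) ?_ ?_
      · intro i j h; simpa using (Prod.ext_iff.1 h).1
      · intro i hi
        simp only [mem_filter, mem_univ, true_and, B] at hi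
        exact ⟨hi.2, hi.1, (adj2 i).symm⟩
  have e3 : #(symmDiff (A.map π.toEmbedding) B) ≤ b + b := by
    rw [symmDiff_def]
    refine (card_union_le _ _).trans (add_le_add ?_ ?_)
    · refine card_le_ncard_edgeBoundary _ (fun j => (.inl (π.symm j), .inr j)) ?_ ?_
      · intro i j h; simpa using (Prod.ext_iff.1 h).2
      · intro j hj
        obtain ⟨h1, h2⟩ := mem_sdiff.1 hj
        obtain ⟨i, hi, rfl⟩ := mem_map.1 h1
        simp only [mem_filter, mem_univ, true_and, A, B] at hi h2
        refine ⟨?_, h2, ?_⟩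
        · simpa using hi
        · simpa using adj3 i
    · refine card_le_ncard_edgeBoundary _ (fun j => (.inr j, .inl (π.symm j))) ?_ ?_
      · intro i j h; simpa using (Prod.ext_iff.1 h).1
      · intro j hj
        obtain ⟨h1, h2⟩ := mem_sdiff.1 hj
        have h3 := (adj3 (π.symm j)).symm
        rw [Equiv.apply_symm_apply] at h3
        refine ⟨by simpa [B] using h1, fun h => h2 (mem_map.2 ⟨π.symm j, by simpa [A] using h,
          by simp⟩), h3⟩
  have := hπ A B (by omega)
  omega

theorem exists_isCubicExpanderSequence :
    ∃ (N : ℕ → ℕ) (T : ∀ n, SimpleGraph (Fin (N n))), IsCubicExpanderSequence N T := by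
  choose π hπ using fun n : ℕ => exists_twistedPrism_expander (show 3 ≤ n + 3 by omega)
  let e : ∀ n : ℕ, Fin (2 * (n + 3)) ≃ ZMod (n + 3) ⊕ ZMod (n + 3) := fun n =>
    (Fintype.equivFinOfCardEq (by rw [Fintype.card_sum, ZMod.card]; ring)).symm
  refine ⟨fun n => 2 * (n + 3), fun n => (twistedPrism (π n)).comap (e n), ?_, fun n => by positivity,
    fun n v => ?_, 1 / 600, by norm_num, fun n S hS => ?_⟩
  · intro a b h
    simp only
    omega
  · have := twistedPrism_ncard_neighborSet (show 3 ≤ n + 3 by omega) (π n) (e n v)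
    rwa [← Set.ncard_preimage_of_injective_subset_range (e n).injective (by simp)] at this
  · have h1 : (e n '' S).ncard = S.ncard := Set.ncard_image_of_injective _ (e n).injective
    have h2 := hπ n (e n '' S) (by rw [h1]; exact hS)
    have h3 : (edgeBoundary (twistedPrism (π n)) (e n '' S)).ncard =
        ({q | q.1 ∈ S ∧ q.2 ∉ S ∧ ((twistedPrism (π n)).comap (e n)).Adj q.1 q.2} :
          Set (_ × _)).ncard := by
      rw [← Set.ncard_preimage_of_injective_subset_range ((e n).prodCongr (e n)).injective
        (by rw [(Equiv.surjective _).range_eq]; exact Set.subset_univ _)]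
      congr 1
      ext q
      simp [edgeBoundary]
    rw [h1, h3] at h2
    have h4 : (S.ncard : ℝ) ≤ 600 * (({q | q.1 ∈ S ∧ q.2 ∉ S ∧
      ((twistedPrism (π n)).comap (e n)).Adj q.1 q.2} : Set (_ × _)).ncard : ℝ) := by
      exact_mod_cast h2
    linarith

/-! ### Irrational rotations -/

theorem rotationGraph_adj {θ : ℝ} {x y : UnitAddCircle} :
    (rotationGraph θ).Adj x y ↔ x ≠ y ∧ (y = x + (θ : UnitAddCircle) ∨ x = y + θ) :=
  SimpleGraph.fromRel_adj _ _ _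

theorem edist_add_nsmul_le (θ : ℝ) (x : UnitAddCircle) (j : ℕ) :
    (rotationGraph θ).edist x (x + j • (θ : UnitAddCircle)) ≤ j := by
  induction j with
  | zero => simp
  | succ j ih =>
    refine (SimpleGraph.edist_triangle (v := x + j • (θ : UnitAddCircle))).trans ?_
    push_cast
    refine add_le_add ih ?_
    by_cases h : x + j • (θ : UnitAddCircle) = x + (j + 1) • (θ : UnitAddCircle)
    · rw [← h, SimpleGraph.edist_self]; exact zero_le_one
    · refine (SimpleGraph.edist_eq_one_iff_adj.2 (rotationGraph_adj.2 ⟨h, Or.inl ?_⟩)).le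
      rw [succ_nsmul, add_assoc]

/-- The forward orbits of an irrational rotation hit a given open set in bounded time. -/
theorem exists_forall_exists_add_nsmul_mem {θ : ℝ} (hθ : Irrational θ) {U : Set UnitAddCircle}
    (hU : IsOpen U) (hne : U.Nonempty) :
    ∃ J : ℕ, ∀ x, ∃ j ≤ J, x + j • (θ : UnitAddCircle) ∈ U := by
  have hd : DenseRange fun n : ℤ => n • (θ : UnitAddCircle) :=
    AddCircle.denseRange_zsmul_coe_iff.2 (by simpa using hθ)
  -- By density of orbits the translates of `U` cover the circle, and by compactness finitely many
  -- suffice. This gives hitting times in `[-M, M]`; starting from `x + M • θ` makes them forward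
  -- times up to `2 * M`.
  obtain ⟨t, ht⟩ := isCompact_univ.elim_finite_subcover
    (fun n : ℤ => (fun x : UnitAddCircle => x + n • (θ : UnitAddCircle)) ⁻¹' U)
    (fun n => hU.preimage (by fun_prop)) (by
      intro x _
      obtain ⟨n, hn⟩ := hd.exists_mem_open
        (hU.preimage (show Continuous fun y : UnitAddCircle => x + y by fun_prop))
        (by
          obtain ⟨u, hu⟩ := hne
          exact ⟨u - x, by simpa using hu⟩)
      exact Set.mem_iUnion.2 ⟨n, hn⟩)
  set M := t.sup Int.natAbs
  refine ⟨2 * M, fun x => ?_⟩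
  obtain ⟨n, hn, hx⟩ := Set.mem_iUnion₂.1 (ht (Set.mem_univ (x + M • (θ : UnitAddCircle))))
  have hM : n.natAbs ≤ M := Finset.le_sup (f := Int.natAbs) hn
  refine ⟨(M + n).toNat, by omega, ?_⟩
  have : (M + n).toNat • (θ : UnitAddCircle) = M • (θ : UnitAddCircle) + n • (θ : UnitAddCircle) := by
    rw [← natCast_zsmul, Int.toNat_of_nonneg (by omega), add_zsmul, natCast_zsmul]
  rw [this, ← add_assoc]
  exact hx

theorem nsmul_coe_ne_zero {θ : ℝ} (hθ : Irrational θ) {k : ℕ} (hk : k ≠ 0) :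
    k • (θ : UnitAddCircle) ≠ 0 := by
  have hd : DenseRange fun n : ℤ => n • (θ : UnitAddCircle) :=
    AddCircle.denseRange_zsmul_coe_iff.2 (by simpa using hθ)
  rw [AddCircle.denseRange_zsmul_iff] at hd
  intro h
  exact hk (Nat.eq_zero_of_zero_dvd (hd ▸ addOrderOf_dvd_of_nsmul_eq_zero h))

/-- There are arcs whose first `L` translates under an irrational rotation are disjoint. -/
theorem exists_isOpen_pairwise_disjoint_translates {θ : ℝ} (hθ : Irrational θ) (L : ℕ) :
    ∃ U : Set UnitAddCircle, IsOpen U ∧ U.Nonempty ∧ ∀ i j x, i < j → j < L →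
      x - i • (θ : UnitAddCircle) ∈ U → x - j • (θ : UnitAddCircle) ∉ U := by
  obtain ⟨r, hr, hrL⟩ : ∃ r : ℝ, 0 < r ∧ ∀ k, k ≠ 0 → k < L →
      2 * r ≤ ‖k • (θ : UnitAddCircle)‖ := by
    induction L with
    | zero => exact ⟨1, one_pos, fun k _ h => absurd h (by omega)⟩
    | succ L ih =>
      obtain ⟨r, hr, h⟩ := ih
      by_cases hL : L = 0
      · exact ⟨1, one_pos, fun k _ h => absurd h (by omega)⟩
      · have hp : 0 < ‖L • (θ : UnitAddCircle)‖ := norm_pos_iff.2 (nsmul_coe_ne_zero hθ hL)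
        refine ⟨min r (‖L • (θ : UnitAddCircle)‖ / 2), by positivity, fun k hk hkL => ?_⟩
        rcases Nat.lt_succ_iff_lt_or_eq.1 hkL with h' | rfl
        · exact le_trans (by gcongr; exact min_le_left _ _) (h k hk h')
        · linarith [min_le_right r (‖k • (θ : UnitAddCircle)‖ / 2)]
  refine ⟨Metric.ball 0 r, Metric.isOpen_ball, ⟨0, Metric.mem_ball_self hr⟩, ?_⟩
  intro i j x hij hj hi hj'
  rw [mem_ball_zero_iff] at hi hj'
  have h1 := hrL (j - i) (by omega) (by omega)
  have h2 : (j - i) • (θ : UnitAddCircle) = (x - i • (θ : UnitAddCircle)) - (x - j • (θ : UnitAddCircle)) := by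
    rw [sub_nsmul _ hij.le]; abel
  rw [h2] at h1
  linarith [norm_sub_le (x - i • (θ : UnitAddCircle)) (x - j • (θ : UnitAddCircle))]

/-- For every `L` there is a bound `J` such that every Borel set `B` has a piece of measure at most
`volume B / L` whose removal leaves only orbit segments of length at most `J`. -/
theorem exists_small_cut {θ : ℝ} (hθ : Irrational θ) {L : ℕ} (hL : 0 < L) :
    ∃ J : ℕ, ∀ B : Set UnitAddCircle, MeasurableSet B →
      ∃ I : Set UnitAddCircle, MeasurableSet I ∧ volume (B ∩ I) ≤ (L : ℝ≥0∞)⁻¹ * volume B ∧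
        ∀ x, ∃ j ≤ J, x + j • (θ : UnitAddCircle) ∈ I := by
  obtain ⟨U, hU, hne, hdisj⟩ := exists_isOpen_pairwise_disjoint_translates hθ L
  obtain ⟨J, hJ⟩ := exists_forall_exists_add_nsmul_mem hθ hU hne
  refine ⟨J, fun B hB => ?_⟩
  set I : ℕ → Set UnitAddCircle := fun j => {x | x - j • (θ : UnitAddCircle) ∈ U}
  have hI : ∀ j, MeasurableSet (I j) := fun j =>
    (hU.preimage (show Continuous fun x => x - j • (θ : UnitAddCircle) by fun_prop)).measurableSet
  -- Averaging over `L` disjoint translates of one arc. Only the choice of the translate depends on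
  -- `B`; the hitting bound `J` is common to all of them.
  have hsum : ∑ j ∈ Finset.range L, volume (B ∩ I j) ≤
      ∑ j ∈ Finset.range L, (L : ℝ≥0∞)⁻¹ * volume B := by
    rw [← measure_biUnion_finset _ fun j _ => hB.inter (hI j)]
    · rw [Finset.sum_const, Finset.card_range, nsmul_eq_mul, ← mul_assoc,
        ENNReal.mul_inv_cancel (by exact_mod_cast hL.ne') (ENNReal.natCast_ne_top L), one_mul]
      exact measure_mono (Set.iUnion₂_subset fun j _ => Set.inter_subset_left)
    · intro i hi j hj hij
      have hi' := Finset.mem_range.1 (Finset.mem_coe.1 hi)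
      have hj' := Finset.mem_range.1 (Finset.mem_coe.1 hj)
      refine Set.disjoint_left.2 fun x hx hx' => ?_
      rcases lt_or_gt_of_ne hij with h | h
      · exact hdisj i j x h hj' hx.2 hx'.2
      · exact hdisj j i x h hi' hx'.2 hx.2
  obtain ⟨j, hj, hle⟩ : ∃ j ∈ Finset.range L, volume (B ∩ I j) ≤ (L : ℝ≥0∞)⁻¹ * volume B := by
    by_contra! hcon
    exact absurd hsum (not_le.2 (ENNReal.sum_lt_sum_of_nonempty
      (Finset.nonempty_range_iff.2 hL.ne') hcon))
  refine ⟨I j, hI j, hle, fun x => ?_⟩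
  obtain ⟨i, hi, hx⟩ := hJ (x - j • (θ : UnitAddCircle))
  refine ⟨i, hi, ?_⟩
  simp only [I, Set.mem_ofPred_eq]
  convert hx using 1
  abel

/-! ### Marker sets -/

theorem norm_coe_of_le_half {t : ℝ} (h0 : 0 ≤ t) (h1 : t ≤ 1 / 2) : ‖(t : UnitAddCircle)‖ = t := by
  rw [(AddCircle.norm_coe_eq_abs_iff 1 one_ne_zero).2 (by rw [abs_of_nonneg h0, abs_one]; exact h1),
    abs_of_nonneg h0]

/-- The annuli `a n < ‖x‖ ≤ a n + δ n` fit between the radii `1 / (n + 3)` and `1 / (n + 2)`, so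
they are disjoint and `D = 1` works. Each consists of two arcs, of total length `2 * δ n`, and has
nonempty interior, which gives bounded hitting times. -/
theorem exists_isMarkerSequence {θ : ℝ} (hθ : Irrational θ) {N : ℕ → ℕ} (hN : ∀ n, 0 < N n) :
    ∃ Y, IsMarkerSequence θ N Y := by
  set a : ℕ → ℝ := fun n => 1 / ((n : ℝ) + 3) with ha
  set δ : ℕ → ℝ := fun n => min (1 / ((n : ℝ) + 2) - 1 / ((n : ℝ) + 3))
    (1 / (2 ^ (n + 2) * N n)) with hδ
  have ha0 : ∀ n, 0 < a n := fun n => by simp only [ha]; positivity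
  have hδ0 : ∀ n, 0 < δ n := fun n => by
    refine lt_min ?_ ?_
    · rw [sub_pos]
      exact one_div_lt_one_div_of_lt (by positivity) (by linarith)
    · have := hN n
      positivity
  have hδ1 : ∀ n, a n + δ n ≤ 1 / ((n : ℝ) + 2) := fun n => by
    have := min_le_left (1 / ((n : ℝ) + 2) - 1 / ((n : ℝ) + 3)) (1 / (2 ^ (n + 2) * N n))
    simp only [ha, hδ]
    linarith
  have hhalf : ∀ n, a n + δ n ≤ 1 / 2 := fun n => (hδ1 n).trans
    (one_div_le_one_div_of_le (by norm_num) (by linarith [n.cast_nonneg (α := ℝ)]))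
  have hanti : ∀ n k, n < k → a k + δ k ≤ a n := fun n k h => by
    refine (hδ1 k).trans ?_
    have : (n : ℝ) + 1 ≤ k := by exact_mod_cast h
    exact one_div_le_one_div_of_le (by positivity) (by linarith)
  set Y : ℕ → Set UnitAddCircle := fun n =>
    Metric.closedBall 0 (a n + δ n) \ Metric.closedBall 0 (a n)
  have hmem : ∀ n x, x ∈ Y n ↔ ‖x‖ ≤ a n + δ n ∧ a n < ‖x‖ := fun n x => by
    simp [Y]
  refine ⟨Y, fun n => measurableSet_closedBall.diff measurableSet_closedBall, fun n => ?_,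
    fun n => ?_, 1, fun x => ?_⟩
  · obtain ⟨J, hJ⟩ := exists_forall_exists_add_nsmul_mem hθ
      (U := Metric.ball 0 (a n + δ n) ∩ (Metric.closedBall 0 (a n))ᶜ)
      (Metric.isOpen_ball.inter Metric.isClosed_closedBall.isOpen_compl)
      ⟨((a n + δ n / 2 : ℝ) : UnitAddCircle), by
        have h1 := hδ0 n
        have h2 := ha0 n
        have h3 := hhalf n
        rw [Set.mem_inter_iff, Set.mem_compl_iff, mem_ball_zero_iff, mem_closedBall_zero_iff,
          norm_coe_of_le_half (by linarith) (by linarith)]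
        constructor <;> linarith⟩
    refine ⟨J, fun x => ?_⟩
    obtain ⟨j, hj, hx⟩ := hJ x
    exact ⟨_, ⟨Metric.ball_subset_closedBall hx.1, hx.2⟩,
      (edist_add_nsmul_le θ x j).trans (by exact_mod_cast hj)⟩
  · have h1 := hδ0 n
    have h2 := ha0 n
    have h3 := hhalf n
    rw [measure_sdiff (Metric.closedBall_subset_closedBall (by linarith))
      measurableSet_closedBall.nullMeasurableSet (measure_ne_top _ _),
      AddCircle.volume_closedBall, AddCircle.volume_closedBall, min_eq_right (by linarith),
      min_eq_right (by linarith), ← ENNReal.ofReal_sub _ (by linarith)]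
    apply ENNReal.ofReal_le_ofReal
    have h4 : δ n ≤ 1 / (2 ^ (n + 2) * N n) := min_le_right _ _
    have h5 : (1 : ℝ) / (2 ^ (n + 1) * N n) = 2 * (1 / (2 ^ (n + 2) * N n)) := by
      have : (N n : ℝ) ≠ 0 := by exact_mod_cast (hN n).ne'
      field_simp
      ring
    rw [h5]
    linarith
  · rw [Nat.cast_one, Set.encard_le_one_iff]
    intro n k hn hk
    have hn' := (hmem n x).1 hn
    have hk' := (hmem k x).1 hk
    rcases lt_trichotomy n k with h | h | h
    · linarith [hanti n k h, hn'.2, hk'.1]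
    · exact h
    · linarith [hanti k n h, hn'.1, hk'.2]

variable {N : ℕ → ℕ} {Y : ℕ → Set UnitAddCircle}

/-! ### The space `Xhat` -/

/-- The base point of a point of `Xhat N Y`. -/
def base (x : Xhat N Y) : UnitAddCircle := Sum.elim id (fun z => (z.2.1 : UnitAddCircle)) x

/-- The part of `A` in the `i`-th copy of `Y n`, as a subset of the circle. -/
def slice (A : Set (Xhat N Y)) (n : ℕ) (i : Fin (N n)) : Set UnitAddCircle :=
  {s | ∃ h : s ∈ Y n, (.inr ⟨n, ⟨s, h⟩, i⟩ : Xhat N Y) ∈ A}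

theorem measurable_sigma_mk {ι : Type*} {β : ι → Type*} [∀ i, MeasurableSpace (β i)] (i : ι) :
    Measurable (Sigma.mk i : β i → Sigma β) :=
  fun _ hs => MeasurableSpace.measurableSet_iInf.1 hs i

theorem measurable_copy (n : ℕ) (i : Fin (N n)) :
    Measurable fun s : Y n => (.inr ⟨n, s, i⟩ : Xhat N Y) :=
  measurable_inr.comp ((measurable_sigma_mk (β := fun n => Y n × Fin (N n)) n).comp
    (measurable_id.prodMk measurable_const))

theorem measurable_of_copies {β : Type*} [MeasurableSpace β] {f : Xhat N Y → β}
    (h1 : Measurable fun x => f (.inl x))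
    (h2 : ∀ n i, Measurable fun s : Y n => f (.inr ⟨n, s, i⟩)) : Measurable f := by
  refine measurable_fun_sum h1 ?_
  intro B hB
  rw [MeasurableSpace.measurableSet_iInf]
  intro n
  have : Measurable fun p : Y n × Fin (N n) => f (.inr ⟨n, p⟩) :=
    measurable_from_prod_countable_left (fun i => h2 n i)
  exact this hB

theorem measurable_base : Measurable (base : Xhat N Y → UnitAddCircle) :=
  measurable_of_copies measurable_id fun _ _ => measurable_subtype_coe

theorem slice_eq_image (A : Set (Xhat N Y)) (n : ℕ) (i : Fin (N n)) :
    slice A n i = (↑) '' ((fun s : Y n => (.inr ⟨n, s, i⟩ : Xhat N Y)) ⁻¹' A) := by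
  ext s
  simp [slice]

theorem measurableSet_slice (hY : ∀ n, MeasurableSet (Y n)) {A : Set (Xhat N Y)}
    (hA : MeasurableSet A) (n : ℕ) (i : Fin (N n)) : MeasurableSet (slice A n i) := by
  rw [slice_eq_image]
  exact (hY n).subtype_image (measurable_copy n i hA)

theorem measurableSet_iff_slices (hY : ∀ n, MeasurableSet (Y n)) {A : Set (Xhat N Y)} :
    MeasurableSet A ↔ MeasurableSet (Sum.inl ⁻¹' A) ∧ ∀ n i, MeasurableSet (slice A n i) := by
  refine ⟨fun h => ⟨measurable_inl h, measurableSet_slice hY h⟩, fun ⟨h1, h2⟩ => ?_⟩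
  have : Measurable fun x => x ∈ A := by
    refine measurable_of_copies ?_ fun n i => ?_
    · exact measurableSet_setOfPred.1 h1
    · have := measurable_subtype_coe (p := fun s => s ∈ Y n) (h2 n i)
      refine measurableSet_setOfPred.1 ?_
      convert this using 1
      ext s
      simp [slice]
  exact measurableSet_setOfPred.2 this

/-- The embedding of `Xhat N Y` into a product of standard Borel spaces. -/
def toProd (x : Xhat N Y) : UnitAddCircle × ℕ × ℕ :=
  Sum.elim (fun s => (s, 0, 0)) (fun z => (z.2.1, z.1 + 1, z.2.2)) x

theorem measurable_toProd : Measurable (toProd : Xhat N Y → _) :=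
  measurable_of_copies (measurable_id.prodMk measurable_const)
    fun n i => measurable_subtype_coe.prodMk (measurable_const (a := (n + 1, i.val)))

theorem toProd_injective : Function.Injective (toProd : Xhat N Y → _) := by
  rintro (s | ⟨n, s, i⟩) (t | ⟨m, t, j⟩) h
  · simpa [toProd] using h
  · simp [toProd] at h
  · simp [toProd] at h
  · simp only [toProd, Sum.elim_inr, Prod.mk.injEq, add_left_inj] at h
    obtain ⟨h1, rfl, h3⟩ := h
    rw [Subtype.ext h1, Fin.ext h3]

theorem measurableEmbedding_toProd (hY : ∀ n, MeasurableSet (Y n)) :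
    MeasurableEmbedding (toProd : Xhat N Y → _) := by
  refine ⟨toProd_injective, measurable_toProd, fun A hA => ?_⟩
  have h : toProd '' A = ((fun s : UnitAddCircle => (s, (0 : ℕ), (0 : ℕ))) '' (Sum.inl ⁻¹' A)) ∪
      ⋃ n, ⋃ i : Fin (N n), (fun s : UnitAddCircle => (s, n + 1, i.val)) '' slice A n i := by
    ext p
    simp only [Set.mem_image, Set.mem_union, Set.mem_iUnion]
    constructor
    · rintro ⟨s | ⟨n, s, i⟩, hx, rfl⟩
      · exact Or.inl ⟨s, hx, rfl⟩
      · exact Or.inr ⟨n, i, s, ⟨s.2, hx⟩, rfl⟩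
    · rintro (⟨s, hx, rfl⟩ | ⟨n, i, s, ⟨hs, hx⟩, rfl⟩)
      · exact ⟨_, hx, rfl⟩
      · exact ⟨_, hx, rfl⟩
  have h2 : ∀ (q : ℕ × ℕ) (B : Set UnitAddCircle), MeasurableSet B →
      MeasurableSet ((fun s : UnitAddCircle => (s, q)) '' B) := by
    intro q B hB
    exact (measurableEmbedding_prod_mk_right q).measurableSet_image.2 hB
  rw [h]
  exact (h2 (0, 0) _ (measurable_inl hA)).union (MeasurableSet.iUnion fun n =>
    MeasurableSet.iUnion fun i => h2 (n + 1, i) _ (measurableSet_slice hY hA n i))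

/-- The range is a Borel set, hence standard Borel, and its Polish topology is pulled back. -/
theorem standardBorelSpace_of_measurableEmbedding {α β : Type*} [MeasurableSpace α]
    [MeasurableSpace β] [StandardBorelSpace β] {f : α → β} (hf : MeasurableEmbedding f) :
    StandardBorelSpace α := by
  have := hf.measurableSet_range.standardBorel
  obtain ⟨τ, hborel, hpolish⟩ := this.polish
  let e : α ≃ᵐ Set.range f := hf.equivRange
  let _ : TopologicalSpace α := TopologicalSpace.induced e τ
  have he : Topology.IsInducing e := ⟨rfl⟩
  have : BorelSpace α := ⟨by
    rw [borel_comap, ← hborel.measurable_eq, e.measurableEmbedding.comap_eq]⟩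
  have : PolishSpace α := (e.toEquiv.toHomeomorphOfIsInducing he).isClosedEmbedding.polishSpace
  infer_instance

theorem standardBorelSpace_Xhat (hY : ∀ n, MeasurableSet (Y n)) : StandardBorelSpace (Xhat N Y) :=
  standardBorelSpace_of_measurableEmbedding (measurableEmbedding_toProd hY)

/-! ### The measures -/

theorem copyMeasure_apply (hY : ∀ n, MeasurableSet (Y n)) (c : ∀ n, Fin (N n) → ℝ≥0∞)
    {A : Set (Xhat N Y)} (hA : MeasurableSet A) :
    copyMeasure Y c A = volume (Sum.inl ⁻¹' A : Set UnitAddCircle) +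
      ∑' n, ∑ i, c n i * volume (slice A n i) := by
  rw [copyMeasure, Measure.add_apply, Measure.map_apply measurable_inl hA,
    Measure.sum_apply _ hA]
  congr 1
  refine tsum_congr fun n => ?_
  rw [Measure.finsetSum_apply]
  refine Finset.sum_congr rfl fun i _ => ?_
  rw [Measure.smul_apply, smul_eq_mul, Measure.map_apply (measurable_copy n i) hA,
    (MeasurableEmbedding.subtype_coe (hY n)).comap_apply, ← slice_eq_image]

/-- The criterion does not involve the nonzero weights `c`; this is why `nuHat` and `muHat` have the
same null sets. -/
theorem copyMeasure_eq_zero_iff (hY : ∀ n, MeasurableSet (Y n)) {c : ∀ n, Fin (N n) → ℝ≥0∞}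
    (hc : ∀ n i, c n i ≠ 0) {A : Set (Xhat N Y)} (hA : MeasurableSet A) :
    copyMeasure Y c A = 0 ↔ volume (Sum.inl ⁻¹' A : Set UnitAddCircle) = 0 ∧
      ∀ n i, volume (slice A n i) = 0 := by
  rw [copyMeasure_apply hY c hA]
  simp [hc]

theorem slice_univ (n : ℕ) (i : Fin (N n)) : slice (Set.univ : Set (Xhat N Y)) n i = Y n := by
  ext s
  simp [slice]

theorem weight_ne_zero {k : ℕ} (i : Fin k) : weight i ≠ 0 := by
  unfold weight
  split_ifs <;> simp

theorem two_inv_pow_add_self (l : ℕ) : (2⁻¹ : ℝ≥0∞) ^ (l + 1) + 2⁻¹ ^ (l + 1) = 2⁻¹ ^ l := by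
  rw [pow_succ, ← mul_add, ENNReal.inv_two_add_inv_two, mul_one]

/-- The total weight of the vertices from `l` on is `2⁻¹ ^ l`. -/
theorem sum_weight_Ici {k l : ℕ} (hl : l < k) :
    ∑ i : Fin k with l ≤ i.val, weight i = 2⁻¹ ^ l := by
  obtain ⟨d, hd⟩ : ∃ d, l + 1 + d = k := ⟨k - (l + 1), by omega⟩
  induction d generalizing l with
  | zero =>
    have : (Finset.univ.filter fun i : Fin k => l ≤ i.val) = {⟨l, hl⟩} := by
      ext i
      simp only [Finset.mem_filter, Finset.mem_univ, true_and, Finset.mem_singleton, Fin.ext_iff]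
      omega
    rw [this, Finset.sum_singleton, weight, if_pos (by simp; omega)]
    congr 1
    omega
  | succ d ih =>
    have : (Finset.univ.filter fun i : Fin k => l ≤ i.val) =
        insert ⟨l, hl⟩ (Finset.univ.filter fun i : Fin k => l + 1 ≤ i.val) := by
      ext i
      simp only [Finset.mem_filter, Finset.mem_univ, true_and, Finset.mem_insert, Fin.ext_iff]
      omega
    rw [this, Finset.sum_insert (by simp), ih (by omega) (by omega), weight,
      if_neg (by simp; omega), two_inv_pow_add_self]

theorem sum_weight {k : ℕ} (hk : 0 < k) : ∑ i : Fin k, weight i = 1 := by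
  simpa using sum_weight_Ici hk

/-- The last vertex breaks the pattern: its weight is `2⁻¹ ^ i` instead of `2⁻¹ ^ (i + 1)`. This
bound and the next treat all vertices alike, at the cost of a factor `2` between them. -/
theorem two_inv_pow_succ_le_weight {k : ℕ} (i : Fin k) : 2⁻¹ ^ (i.val + 1) ≤ weight i := by
  unfold weight
  split_ifs with h
  · exact pow_le_pow_right_of_le_one' (by simp) (by omega)
  · exact le_rfl

theorem weight_le_two_inv_pow {k : ℕ} (i : Fin k) : weight i ≤ 2⁻¹ ^ i.val := by
  unfold weight
  split_ifs with h
  · exact pow_le_pow_right_of_le_one' (by simp) (by omega)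
  · exact pow_le_pow_right_of_le_one' (by simp) (by omega)

theorem nu_univ (hY : ∀ n, MeasurableSet (Y n)) :
    nu N Y Set.univ = 1 + ∑' n, N n * volume (Y n) := by
  rw [nu, copyMeasure_apply hY _ .univ]
  simp [slice_univ]

theorem nu_univ_ne_zero (hY : ∀ n, MeasurableSet (Y n)) : nu N Y Set.univ ≠ 0 := by
  rw [nu_univ hY]
  simp

theorem nu_univ_ne_top (hY : ∀ n, MeasurableSet (Y n)) (hN : ∀ n, 0 < N n)
    (hvol : ∀ n, volume (Y n) ≤ ENNReal.ofReal (1 / (2 ^ (n + 1) * N n))) :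
    nu N Y Set.univ ≠ ∞ := by
  rw [nu_univ hY]
  refine ENNReal.add_ne_top.2 ⟨by simp, ne_top_of_le_ne_top (b := ∑' n : ℕ, 2⁻¹ ^ (n + 1)) ?_ ?_⟩
  · rw [ENNReal.tsum_geometric_add_one]
    simp
  · refine ENNReal.tsum_le_tsum fun n => ?_
    have h0 : (0 : ℝ) < N n := by exact_mod_cast hN n
    calc (N n : ℝ≥0∞) * volume (Y n)
        ≤ ENNReal.ofReal (N n) * ENNReal.ofReal (1 / (2 ^ (n + 1) * N n)) := by
          rw [ENNReal.ofReal_natCast]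
          gcongr
          exact hvol n
      _ = ENNReal.ofReal ((2 ^ (n + 1))⁻¹) := by
          rw [← ENNReal.ofReal_mul h0.le]
          congr 1
          field_simp
      _ = _ := by
          rw [ENNReal.ofReal_inv_of_pos (by positivity), ENNReal.ofReal_pow (by norm_num),
            ENNReal.inv_pow]
          simp

/-- The weights in each attached graph sum to `1`, so mass is only redistributed within fibres. -/
theorem nuHat_univ (hY : ∀ n, MeasurableSet (Y n)) (hN : ∀ n, 0 < N n)
    (hvol : ∀ n, volume (Y n) ≤ ENNReal.ofReal (1 / (2 ^ (n + 1) * N n))) :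
    nuHat N Y Set.univ = 1 := by
  have h : copyMeasure Y (fun n i => weight i * N n) (Set.univ : Set (Xhat N Y)) =
      nu N Y Set.univ := by
    rw [nu_univ hY, copyMeasure_apply hY _ .univ]
    simp only [slice_univ, Set.preimage_univ]
    congr 1
    · simp
    · refine tsum_congr fun n => ?_
      rw [← Finset.sum_mul, ← Finset.sum_mul, sum_weight (hN n), one_mul]
  rw [nuHat, Measure.smul_apply, h, smul_eq_mul,
    ENNReal.inv_mul_cancel (nu_univ_ne_zero hY) (nu_univ_ne_top hY hN hvol)]

theorem nuHat_eq_zero_iff (hY : ∀ n, MeasurableSet (Y n)) (hN : ∀ n, 0 < N n)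
    (hvol : ∀ n, volume (Y n) ≤ ENNReal.ofReal (1 / (2 ^ (n + 1) * N n)))
    {A : Set (Xhat N Y)} (hA : MeasurableSet A) :
    nuHat N Y A = 0 ↔ volume (Sum.inl ⁻¹' A : Set UnitAddCircle) = 0 ∧
      ∀ n i, volume (slice A n i) = 0 := by
  rw [nuHat, Measure.smul_apply, smul_eq_mul, mul_eq_zero, ENNReal.inv_eq_zero,
    or_iff_right (nu_univ_ne_top hY hN hvol), copyMeasure_eq_zero_iff hY _ hA]
  intro n i
  exact mul_ne_zero (weight_ne_zero i) (by exact_mod_cast (hN n).ne')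

theorem muHat_eq_zero_iff (hY : ∀ n, MeasurableSet (Y n)) (hN : ∀ n, 0 < N n)
    (hvol : ∀ n, volume (Y n) ≤ ENNReal.ofReal (1 / (2 ^ (n + 1) * N n)))
    {A : Set (Xhat N Y)} (hA : MeasurableSet A) :
    muHat N Y A = 0 ↔ volume (Sum.inl ⁻¹' A : Set UnitAddCircle) = 0 ∧
      ∀ n i, volume (slice A n i) = 0 := by
  rw [muHat, Measure.smul_apply, smul_eq_mul, mul_eq_zero, ENNReal.inv_eq_zero,
    or_iff_right (nu_univ_ne_top hY hN hvol), nu, copyMeasure_eq_zero_iff hY _ hA]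
  intro n i
  exact one_ne_zero

variable {θ : ℝ} {T : ∀ n, SimpleGraph (Fin (N n))}

/-! ### The graph `Hhat` as a measured graph of bounded degree -/

theorem base_of_adj {x y : Xhat N Y} (h : (Hhat θ T Y).Adj x y) :
    ∃ j : ℤ, base y = base x + j • (θ : UnitAddCircle) := by
  cases h with
  | base x y h =>
    rcases (rotationGraph_adj.1 h).2 with h | h
    · exact ⟨1, by simpa [base] using h⟩
    · exact ⟨-1, by simp [base, h]⟩
  | up n s t h => exact ⟨0, by simp [base]⟩
  | down n s t h => exact ⟨0, by simp [base]⟩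
  | fiber n s i j h => exact ⟨0, by simp [base]⟩

theorem base_of_reachable {x y : Xhat N Y} (h : (Hhat θ T Y).Reachable x y) :
    ∃ j : ℤ, base y = base x + j • (θ : UnitAddCircle) := by
  obtain ⟨w⟩ := h
  induction w with
  | nil => exact ⟨0, by simp⟩
  | cons h _ ih =>
    obtain ⟨j, hj⟩ := base_of_adj h
    obtain ⟨k, hk⟩ := ih
    exact ⟨j + k, by rw [hk, hj, add_zsmul, add_assoc]⟩

theorem measurableSet_rotationGraph_adj (θ : ℝ) :
    MeasurableSet {q : UnitAddCircle × UnitAddCircle | (rotationGraph θ).Adj q.1 q.2} := by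
  simp only [rotationGraph_adj]
  refine MeasurableSet.inter (MeasurableSet.compl ?_) (MeasurableSet.union ?_ ?_)
  · exact (isClosed_eq continuous_fst continuous_snd).measurableSet
  · exact (isClosed_eq continuous_snd (by fun_prop)).measurableSet
  · exact (isClosed_eq continuous_fst (by fun_prop)).measurableSet

/-- The edge set is a countable union of injective Borel images of standard Borel spaces, so the
Lusin–Souslin theorem applies. -/
theorem measurableSet_Hhat_adj (hY : ∀ n, MeasurableSet (Y n)) :
    MeasurableSet {q : Xhat N Y × Xhat N Y | (Hhat θ T Y).Adj q.1 q.2} := by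
  have := standardBorelSpace_Xhat (N := N) hY
  have hYb : ∀ n, StandardBorelSpace (Y n) := fun n => (hY n).standardBorel
  have hcopy : ∀ n (i : Fin (N n)), Function.Injective
      fun s : Y n => (.inr ⟨n, s, i⟩ : Xhat N Y) := fun n i s t h => by simpa using h
  have hinl : ∀ n, Measurable fun s : Y n => (.inl s : Xhat N Y) := fun n =>
    measurable_inl.comp measurable_subtype_coe
  have heq : {q : Xhat N Y × Xhat N Y | (Hhat θ T Y).Adj q.1 q.2} =
      (Prod.map .inl .inl '' {q : UnitAddCircle × UnitAddCircle | (rotationGraph θ).Adj q.1 q.2}) ∪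
      (⋃ n, ⋃ t : Fin (N n), ⋃ _ : t.val = 0,
        Set.range fun s : Y n => ((.inl s : Xhat N Y), (.inr ⟨n, s, t⟩ : Xhat N Y))) ∪
      (⋃ n, ⋃ t : Fin (N n), ⋃ _ : t.val = 0,
        Set.range fun s : Y n => ((.inr ⟨n, s, t⟩ : Xhat N Y), (.inl s : Xhat N Y))) ∪
      (⋃ n, ⋃ i : Fin (N n), ⋃ j : Fin (N n), ⋃ _ : (T n).Adj i j,
        Set.range fun s : Y n => ((.inr ⟨n, s, i⟩ : Xhat N Y), (.inr ⟨n, s, j⟩ : Xhat N Y))) := by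
    ext ⟨x, y⟩
    simp only [Set.mem_union, Set.mem_iUnion, Set.mem_range, Set.mem_image, Set.mem_ofPred_eq,
      Prod.map, Prod.mk.injEq, Prod.exists]
    constructor
    · intro h
      cases h with
      | base x y h => exact .inl (.inl (.inl ⟨x, y, h, rfl, rfl⟩))
      | up n s t h => exact .inl (.inl (.inr ⟨n, t, h, s, rfl, rfl⟩))
      | down n s t h => exact .inl (.inr ⟨n, t, h, s, rfl, rfl⟩)
      | fiber n s i j h => exact .inr ⟨n, i, j, h, s, rfl, rfl⟩
    · rintro (((⟨x, y, h, rfl, rfl⟩ | ⟨n, t, h, s, rfl, rfl⟩) | ⟨n, t, h, s, rfl, rfl⟩) |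
        ⟨n, i, j, h, s, rfl, rfl⟩)
      · exact .base x y h
      · exact .up n s t h
      · exact .down n s t h
      · exact .fiber n s i j h
  rw [heq]
  refine MeasurableSet.union (MeasurableSet.union (MeasurableSet.union ?_ ?_) ?_) ?_
  · exact (((measurable_inl.comp measurable_fst).prodMk
      (measurable_inl.comp measurable_snd)).measurableEmbedding
      (Sum.inl_injective.prodMap Sum.inl_injective)).measurableSet_image.2
      (measurableSet_rotationGraph_adj θ)
  · refine .iUnion fun n => .iUnion fun t => .iUnion fun _ => ?_
    exact (((hinl n).prodMk (measurable_copy n t)).measurableEmbedding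
      fun s s' h => hcopy n t (Prod.ext_iff.1 h).2).measurableSet_range
  · refine .iUnion fun n => .iUnion fun t => .iUnion fun _ => ?_
    exact (((measurable_copy n t).prodMk (hinl n)).measurableEmbedding
      fun s s' h => hcopy n t (Prod.ext_iff.1 h).1).measurableSet_range
  · refine .iUnion fun n => .iUnion fun i => .iUnion fun j => .iUnion fun _ => ?_
    exact (((measurable_copy n i).prodMk (measurable_copy n j)).measurableEmbedding
      fun s s' h => hcopy n i (Prod.ext_iff.1 h).1).measurableSet_range

theorem hasBoundedDegree_Hhat (hN : ∀ n, 0 < N n)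
    (hT : ∀ n v, ((T n).neighborSet v).ncard = 3) {D : ℕ}
    (hD : ∀ x, {n | x ∈ Y n}.encard ≤ D) : HasBoundedDegree (Hhat θ T Y) := by
  classical
  refine ⟨D + 4, ?_⟩
  rintro (x | ⟨n, s, i⟩)
  · have hsub : (Hhat θ T Y).neighborSet (.inl x) ⊆
        {.inl (x + (θ : UnitAddCircle)), .inl (x - θ)} ∪
        (fun n => if h : x ∈ Y n then (.inr ⟨n, ⟨x, h⟩, ⟨0, hN n⟩⟩ : Xhat N Y) else .inl x) ''
          {n | x ∈ Y n} := by
      intro y hy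
      have hy' : HhatAdj θ T Y (.inl x) y := hy
      cases hy' with
      | base x y h =>
        left
        rcases (rotationGraph_adj.1 h).2 with h | h
        · exact Or.inl (by rw [h])
        · exact Or.inr (by rw [h, add_sub_cancel_right]; rfl)
      | up n s t h =>
        right
        refine ⟨n, s.2, ?_⟩
        simp only [Subtype.coe_prop, dite_true, Subtype.coe_eta]
        rw [show t = ⟨0, hN n⟩ from Fin.ext h]
    calc _ ≤ _ := Set.encard_le_encard hsub
      _ ≤ _ := Set.encard_union_le _ _
      _ ≤ 2 + D := add_le_add ((Set.encard_insert_le _ _).trans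
          (by rw [Set.encard_singleton]; norm_num)) ((Set.encard_image_le _ _).trans (hD x))
      _ ≤ ((D + 4 : ℕ) : ℕ∞) := by
        rw [add_comm]; push_cast; gcongr; norm_num
  · have hsub : (Hhat θ T Y).neighborSet (.inr ⟨n, s, i⟩) ⊆ {.inl (s : UnitAddCircle)} ∪
        (fun j => (.inr ⟨n, s, j⟩ : Xhat N Y)) '' (T n).neighborSet i := by
      intro y hy
      have hy' : HhatAdj θ T Y (.inr ⟨n, s, i⟩) y := hy
      cases hy' with
      | down n s t h => exact Or.inl rfl
      | fiber n s i j h => exact Or.inr ⟨j, h, rfl⟩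
    have h3 : ((T n).neighborSet i).encard = 3 := by
      rw [← (Set.toFinite _).cast_ncard_eq, hT n i]
      rfl
    calc _ ≤ _ := Set.encard_le_encard hsub
      _ ≤ _ := Set.encard_union_le _ _
      _ ≤ 1 + 3 := add_le_add (Set.encard_singleton _).le ((Set.encard_image_le _ _).trans h3.le)
      _ ≤ ((D + 4 : ℕ) : ℕ∞) := by push_cast; norm_num

theorem isMeasuredGraph_Hhat (hY : ∀ n, MeasurableSet (Y n)) (hN : ∀ n, 0 < N n)
    (hvol : ∀ n, volume (Y n) ≤ ENNReal.ofReal (1 / (2 ^ (n + 1) * N n)))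
    (hdeg : HasBoundedDegree (Hhat θ T Y)) : IsMeasuredGraph (Hhat θ T Y) (nuHat N Y) where
  standardBorel := standardBorelSpace_Xhat hY
  borel := measurableSet_Hhat_adj hY
  countable_degree x := by
    obtain ⟨d, hd⟩ := hdeg
    exact (Set.finite_of_encard_le_coe (hd x)).countable
  prob := ⟨nuHat_univ hY hN hvol⟩
  quasiInvariant A hA hA0 := by
    obtain ⟨h1, h2⟩ := (nuHat_eq_zero_iff hY hN hvol hA).1 hA0
    -- `P` is the projection of `A` to the circle and `Q` its saturation under the rotation. Edges
    -- move base points within rotation orbits, so the null set `base ⁻¹' Q` contains every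
    -- component that meets `A`.
    set P : Set UnitAddCircle := (Sum.inl ⁻¹' A) ∪ ⋃ n, ⋃ i, slice A n i
    have hPm : MeasurableSet P := (measurable_inl hA).union
      (.iUnion fun n => .iUnion fun i => measurableSet_slice hY hA n i)
    have hP0 : volume P = 0 := measure_union_null h1
      (measure_iUnion_null fun n => measure_iUnion_null fun i => h2 n i)
    set Q : Set UnitAddCircle := ⋃ j : ℤ, (fun x => x - j • (θ : UnitAddCircle)) ⁻¹' P
    have hQm : MeasurableSet Q := .iUnion fun j => (measurable_sub_const _) hPm
    have hQ0 : volume Q = 0 := measure_iUnion_null fun j => by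
      rw [(measurePreserving_sub_right volume _).measure_preimage hPm.nullMeasurableSet, hP0]
    refine measure_mono_null (t := base ⁻¹' Q) ?_ ?_
    · rintro x ⟨a, ha, hr⟩
      obtain ⟨j, hj⟩ := base_of_reachable hr
      refine Set.mem_iUnion.2 ⟨j, ?_⟩
      rw [Set.mem_preimage, hj, add_sub_cancel_right]
      rcases a with s | ⟨n, s, i⟩
      · exact Or.inl ha
      · exact Or.inr (Set.mem_iUnion₂.2 ⟨n, i, s.2, ha⟩)
    · refine (nuHat_eq_zero_iff hY hN hvol (measurable_base hQm)).2 ⟨hQ0, fun n i => ?_⟩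
      refine measure_mono_null ?_ hQ0
      rintro s ⟨hs, hx⟩
      exact hx

theorem nuHat_absolutelyContinuous_muHat (hY : ∀ n, MeasurableSet (Y n)) (hN : ∀ n, 0 < N n)
    (hvol : ∀ n, volume (Y n) ≤ ENNReal.ofReal (1 / (2 ^ (n + 1) * N n))) :
    nuHat N Y ≪ muHat N Y :=
  Measure.AbsolutelyContinuous.mk fun _ hA h =>
    (nuHat_eq_zero_iff hY hN hvol hA).2 ((muHat_eq_zero_iff hY hN hvol hA).1 h)

theorem muHat_absolutelyContinuous_nuHat (hY : ∀ n, MeasurableSet (Y n)) (hN : ∀ n, 0 < N n)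
    (hvol : ∀ n, volume (Y n) ≤ ENNReal.ofReal (1 / (2 ^ (n + 1) * N n))) :
    muHat N Y ≪ nuHat N Y :=
  Measure.AbsolutelyContinuous.mk fun _ hA h =>
    (muHat_eq_zero_iff hY hN hvol hA).2 ((nuHat_eq_zero_iff hY hN hvol hA).1 h)

/-! ### Uniform hyperfiniteness -/

theorem eq_of_reachable_of_adj {V α : Type*} {G : SimpleGraph V} {F : V → α}
    (hF : ∀ x y, G.Adj x y → F x = F y) {x y : V} (h : G.Reachable x y) : F x = F y := by
  obtain ⟨w⟩ := h
  induction w with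
  | nil => rfl
  | cons h _ ih => exact (hF _ _ h).trans ih

/-- To verify hyperfiniteness of an induced graph it suffices to find a small set `T` and a
function that is constant along the remaining edges and whose fibres are small. -/
theorem isEpsHyperfinite_induce {X α : Type*} [MeasurableSpace X] {G : SimpleGraph X}
    {μ : Measure X} {A T : Set X} {ε : ℝ} {K : ℕ} (hA : MeasurableSet A)
    (hT : MeasurableSet T) (hsmall : μ (A ∩ T) < ENNReal.ofReal ε * μ A)
    (F : X → α) (hF : ∀ x ∈ A \ T, ∀ y ∈ A \ T, G.Adj x y → F x = F y)
    (hK : ∀ z, {x ∈ A \ T | F x = z}.encard ≤ K) :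
    IsEpsHyperfinite (G.induce A) (inducedMeasure μ A) ε K := by
  refine ⟨(↑) ⁻¹' T, measurable_subtype_coe hT, ?_, fun c => ?_⟩
  · rw [inducedMeasure, Measure.smul_apply, smul_eq_mul,
      (MeasurableEmbedding.subtype_coe hA).comap_apply, Subtype.image_preimage_coe, mul_comm,
      ← div_eq_mul_inv]
    exact ENNReal.div_lt_of_lt_mul hsmall
  · induction c using SimpleGraph.ConnectedComponent.ind with
    | h v =>
      refine le_trans ?_ (hK (F v))
      have hinj : Function.Injective
          fun w : (((↑) ⁻¹' T : Set A)ᶜ : Set A) => ((w : A) : X) :=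
        Subtype.coe_injective.comp Subtype.coe_injective
      rw [← hinj.encard_image]
      apply Set.encard_le_encard
      rintro _ ⟨w, hw, rfl⟩
      refine ⟨⟨w.1.2, w.2⟩, ?_⟩
      refine eq_of_reachable_of_adj (F := fun w : (((↑) ⁻¹' T : Set A)ᶜ : Set A) => F w) ?_
        (SimpleGraph.ConnectedComponent.exact
          ((SimpleGraph.ConnectedComponent.mem_supp_iff _ _).1 hw))
      intro x y hxy
      exact hF _ ⟨x.1.2, x.2⟩ _ ⟨y.1.2, y.2⟩ hxy

/-- `F x` is the first point of `I` on the forward orbit of `x`. Its fibres are orbit segments of at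
most `J + 1` points, and it can only change along an edge at a point of `I`. -/
theorem exists_forward_hit {t : UnitAddCircle} {I : Set UnitAddCircle} {J : ℕ}
    (hI : ∀ x, ∃ j ≤ J, x + j • t ∈ I) :
    ∃ F : UnitAddCircle → UnitAddCircle, (∀ x ∉ I, F (x + t) = F x) ∧
      ∀ x, ∃ j ≤ J, x + j • t = F x := by
  classical
  have hI' : ∀ x, ∃ j, x + j • t ∈ I := fun x => (hI x).imp fun _ h => h.2
  refine ⟨fun x => x + Nat.find (hI' x) • t, fun x hx => ?_, fun x => ?_⟩
  · have h : Nat.find (hI' x) = Nat.find (hI' (x + t)) + 1 := by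
      rw [Nat.find_eq_iff]
      constructor
      · have := Nat.find_spec (hI' (x + t))
        rwa [add_assoc, ← succ_nsmul'] at this
      · intro n hn
        cases n with
        | zero => simpa using hx
        | succ n =>
          have := Nat.find_min (hI' (x + t)) (Nat.lt_of_succ_lt_succ hn)
          rwa [add_assoc, ← succ_nsmul'] at this
    simp only [h]
    rw [succ_nsmul', add_assoc]
  · obtain ⟨j, hj, hx⟩ := hI x
    exact ⟨_, (Nat.find_min' (hI' x) hx).trans hj, rfl⟩

theorem encard_biUnion_le_card_mul {ι α : Type*} (t : Finset ι) (f : ι → Set α) {k : ℕ∞}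
    (h : ∀ i ∈ t, (f i).encard ≤ k) : (⋃ i ∈ t, f i).encard ≤ t.card * k := by
  classical
  induction t using Finset.induction_on with
  | empty => simp
  | insert a t ha ih =>
    rw [Finset.set_biUnion_insert, Finset.card_insert_of_notMem ha]
    push_cast
    rw [add_comm, add_mul, one_mul]
    calc _ ≤ _ := Set.encard_union_le _ _
      _ ≤ k + t.card * k := add_le_add (h a (by simp)) (ih fun i hi => h i (by simp [hi]))
      _ = _ := by rw [add_comm]

/-- The points over `I` in the circle, and, in each attached graph, the vertices whose number
exceeds the number of some vertex in `A` by more than `m`. -/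
def cutSet (A : Set (Xhat N Y)) (I : Set UnitAddCircle) (m : ℕ) : Set (Xhat N Y) :=
  {x | Sum.elim (· ∈ I)
    (fun z => ∃ i : Fin (N z.1), i.val + (m + 1) ≤ z.2.2.val ∧ .inr ⟨z.1, z.2.1, i⟩ ∈ A) x}

theorem slice_cutSet (A : Set (Xhat N Y)) (I : Set UnitAddCircle) (m n : ℕ) (i : Fin (N n)) :
    slice (cutSet A I m) n i =
      ⋃ i' ∈ (Finset.univ.filter fun i' : Fin (N n) => i'.val + (m + 1) ≤ i.val),
        slice A n i' := by
  ext s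
  simp only [slice, cutSet, Set.mem_iUnion, Finset.mem_filter, Finset.mem_univ, true_and,
    Set.mem_ofPred_eq, Sum.elim_inr]
  constructor
  · rintro ⟨h, i', h1, h2⟩
    exact ⟨i', h1, h, h2⟩
  · rintro ⟨i', h1, h, h2⟩
    exact ⟨h, i', h1, h2⟩

theorem measurableSet_cutSet (hY : ∀ n, MeasurableSet (Y n)) {A : Set (Xhat N Y)}
    (hA : MeasurableSet A) {I : Set UnitAddCircle} (hI : MeasurableSet I) (m : ℕ) :
    MeasurableSet (cutSet A I m) := by
  refine (measurableSet_iff_slices hY).2 ⟨hI, fun n i => ?_⟩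
  rw [slice_cutSet]
  exact Finset.measurableSet_biUnion _ fun i' _ => measurableSet_slice hY hA n i'

theorem sum_weight_le {k : ℕ} (l : ℕ) : ∑ i : Fin k with l ≤ i.val, weight i ≤ 2⁻¹ ^ l := by
  by_cases hl : l < k
  · exact (sum_weight_Ici hl).le
  · rw [Finset.sum_eq_zero]
    · exact zero_le
    · intro i hi
      have := (Finset.mem_filter.1 hi).2
      omega

/-- Each vertex `i'` in `A` is charged with all vertices numbered at least `i' + m + 1`. Their total
weight is at most `2⁻¹ ^ (i' + m + 1)`, that is, at most `2⁻¹ ^ m` times the weight of `i'`. -/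
theorem copyMeasure_inter_cutSet_le (hY : ∀ n, MeasurableSet (Y n)) {A : Set (Xhat N Y)}
    (hA : MeasurableSet A) {I : Set UnitAddCircle} (hI : MeasurableSet I) {m : ℕ}
    (hAI : volume ((Sum.inl ⁻¹' A : Set UnitAddCircle) ∩ I) ≤
      2⁻¹ ^ m * volume (Sum.inl ⁻¹' A : Set UnitAddCircle)) :
    copyMeasure Y (fun n i => weight i * N n) (A ∩ cutSet A I m) ≤
      2⁻¹ ^ m * copyMeasure Y (fun n i => weight i * N n) A := by
  rw [copyMeasure_apply hY _ (hA.inter (measurableSet_cutSet hY hA hI m)),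
    copyMeasure_apply hY _ hA, mul_add, ← ENNReal.tsum_mul_left]
  refine add_le_add hAI (ENNReal.tsum_le_tsum fun n => ?_)
  calc ∑ i, weight i * N n * volume (slice (A ∩ cutSet A I m) n i)
      ≤ ∑ i : Fin (N n), ∑ i' : Fin (N n) with i'.val + (m + 1) ≤ i.val,
          weight i * N n * volume (slice A n i') := by
        refine Finset.sum_le_sum fun i _ => ?_
        rw [← Finset.mul_sum]
        gcongr
        refine le_trans (measure_mono ?_) (measure_biUnion_finset_le _ _)
        rw [← slice_cutSet A I]
        rintro s ⟨h, hs⟩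
        exact ⟨h, hs.2⟩
    _ = ∑ i' : Fin (N n), ∑ i : Fin (N n) with i'.val + (m + 1) ≤ i.val,
          weight i * N n * volume (slice A n i') :=
        Finset.sum_comm' (by simp)
    _ ≤ ∑ i' : Fin (N n), 2⁻¹ ^ m * (weight i' * N n * volume (slice A n i')) := by
        refine Finset.sum_le_sum fun i' _ => ?_
        rw [← Finset.sum_mul, ← Finset.sum_mul, ← mul_assoc, ← mul_assoc]
        gcongr
        calc _ ≤ _ := sum_weight_le _
          _ = 2⁻¹ ^ m * 2⁻¹ ^ (i'.val + 1) := by rw [← pow_add]; congr 1; omega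
          _ ≤ _ := by gcongr; exact two_inv_pow_succ_le_weight i'
    _ = _ := by rw [← Finset.mul_sum]

/-- Few points of `A` outside the cut set lie over a given point of the circle. -/
theorem encard_fibre_diff_cutSet_le {D : ℕ} (hD : ∀ x, {n | x ∈ Y n}.encard ≤ D)
    (A : Set (Xhat N Y)) (I : Set UnitAddCircle) (m : ℕ) (s : UnitAddCircle) :
    {x ∈ A \ cutSet A I m | base x = s}.encard ≤ 1 + D * (m + 1) := by
  classical
  have hfin : {n | s ∈ Y n}.Finite := Set.finite_of_encard_le_coe (hD s)
  have hcard : (hfin.toFinset.card : ℕ∞) ≤ D := by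
    rw [← hfin.encard_eq_coe_toFinset_card]
    exact hD s
  have hsub : {x ∈ A \ cutSet A I m | base x = s} ⊆ {.inl s} ∪ ⋃ n ∈ hfin.toFinset,
      {x | x ∈ A \ cutSet A I m ∧ ∃ (h : s ∈ Y n) (i : Fin (N n)), x = .inr ⟨n, ⟨s, h⟩, i⟩} := by
    rintro (x | ⟨n, t, i⟩) ⟨hx, rfl⟩
    · exact Or.inl rfl
    · refine Or.inr (Set.mem_iUnion₂.2 ⟨n, ?_, hx, t.2, i, rfl⟩)
      simp [base]
  refine (Set.encard_le_encard hsub).trans ((Set.encard_union_le _ _).trans ?_)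
  refine add_le_add (Set.encard_singleton _).le ?_
  refine (encard_biUnion_le_card_mul _ _ (k := m + 1) fun n hn => ?_).trans (by gcongr)
  have hs : s ∈ Y n := by simpa using hn
  set Z : Set (Fin (N n)) := {i | (.inr ⟨n, ⟨s, hs⟩, i⟩ : Xhat N Y) ∈ A \ cutSet A I m}
  have hZ : {x | x ∈ A \ cutSet A I m ∧ ∃ (h : s ∈ Y n) (i : Fin (N n)),
      x = .inr ⟨n, ⟨s, h⟩, i⟩} ⊆ (fun i => (.inr ⟨n, ⟨s, hs⟩, i⟩ : Xhat N Y)) '' Z := by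
    rintro _ ⟨hx, h, i, rfl⟩
    exact ⟨i, hx, rfl⟩
  refine (Set.encard_le_encard hZ).trans ((Set.encard_image_le _ _).trans ?_)
  rcases Z.eq_empty_or_nonempty with h0 | hne
  · simp [h0]
  -- With `i₀` the least remaining vertex, any vertex numbered `i₀ + m + 1` or more is in the cut
  -- set because of `i₀`.
  · obtain ⟨i₀, hi₀, hmin⟩ := Set.exists_min_image Z id (Set.toFinite _) hne
    have : (Fin.val '' Z) ⊆ ((Finset.Ico i₀.val (i₀.val + (m + 1)) : Finset ℕ) : Set ℕ) := by
      rintro _ ⟨i, hi, rfl⟩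
      rw [Finset.coe_Ico]
      refine ⟨hmin i hi, ?_⟩
      by_contra! hcon
      exact hi.2 ⟨i₀, hcon, hi₀.1⟩
    rw [← Fin.val_injective.encard_image]
    refine (Set.encard_le_encard this).trans ?_
    rw [Set.encard_coe_eq_coe_finsetCard, Nat.card_Ico]
    simp

theorem isUniformlyHyperfinite_Hhat (hθ : Irrational θ) (hY : ∀ n, MeasurableSet (Y n))
    (hN : ∀ n, 0 < N n)
    (hvol : ∀ n, volume (Y n) ≤ ENNReal.ofReal (1 / (2 ^ (n + 1) * N n))) {D : ℕ}
    (hD : ∀ x, {n | x ∈ Y n}.encard ≤ D) :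
    IsUniformlyHyperfinite (Hhat θ T Y) (nuHat N Y) := by
  intro ε hε
  obtain ⟨m, hm⟩ := ENNReal.exists_inv_two_pow_lt (ENNReal.ofReal_pos.2 hε).ne'
  obtain ⟨J, hJ⟩ := exists_small_cut hθ (L := 2 ^ m) (by positivity)
  -- A segment has at most `J + 1` base points, each carrying itself and at most `m + 1` vertices in
  -- each of at most `D` attached graphs. Neither `J` nor `m` depends on `A`.
  refine ⟨(J + 1) * (1 + D * (m + 1)), by nlinarith [Nat.zero_le (J * (1 + D * (m + 1)))],
    fun A hA hpos => ?_⟩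
  obtain ⟨I, hI, hIvol, hIJ⟩ := hJ (Sum.inl ⁻¹' A) (measurable_inl hA)
  obtain ⟨F, hF1, hF2⟩ := exists_forward_hit hIJ
  have hfin : nuHat N Y A ≠ ∞ :=
    ne_top_of_le_ne_top ENNReal.one_ne_top ((measure_mono (Set.subset_univ A)).trans
      (nuHat_univ hY hN hvol).le)
  refine isEpsHyperfinite_induce hA (measurableSet_cutSet hY hA hI m) ?_
    (fun x => F (base x)) ?_ ?_
  · refine lt_of_le_of_lt ?_ (ENNReal.mul_lt_mul_left hpos.ne' hfin hm)
    rw [nuHat, Measure.smul_apply, Measure.smul_apply, smul_eq_mul, smul_eq_mul, mul_left_comm]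
    gcongr
    refine copyMeasure_inter_cutSet_le hY hA hI ?_
    simpa [ENNReal.inv_pow] using hIvol
  · rintro x ⟨-, hx⟩ y ⟨-, hy⟩ hxy
    cases hxy with
    | base x y h =>
      simp only [base, Sum.elim_inl, id]
      rcases (rotationGraph_adj.1 h).2 with rfl | rfl
      · exact (hF1 x hx).symm
      · exact hF1 y hy
    | up n s t h => rfl
    | down n s t h => rfl
    | fiber n s i j h => rfl
  · intro z
    have hsub : {x ∈ A \ cutSet A I m | F (base x) = z} ⊆ ⋃ j ∈ Finset.range (J + 1),
        {x ∈ A \ cutSet A I m | base x = z - j • (θ : UnitAddCircle)} := by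
      rintro x ⟨hx, rfl⟩
      obtain ⟨j, hj, h⟩ := hF2 (base x)
      exact Set.mem_iUnion₂.2 ⟨j, Finset.mem_range.2 (by omega), hx, eq_sub_of_add_eq h⟩
    refine (Set.encard_le_encard hsub).trans ((encard_biUnion_le_card_mul _ _ fun j _ =>
      encard_fibre_diff_cutSet_le hD A I m _).trans ?_)
    simp

/-! ### Expansion and families of distributions -/

theorem encard_edist_le_le {V : Type*} {G : SimpleGraph V} {d : ℕ}
    (hd : ∀ x, (G.neighborSet x).encard ≤ d) (R : ℕ) (z : V) :
    {x | G.edist x z ≤ R}.encard ≤ ((d + 1) ^ R : ℕ) := by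
  induction R with
  | zero =>
    have : {x | G.edist x z ≤ (0 : ℕ)} = {z} := by
      ext x
      simp [SimpleGraph.edist_eq_zero_iff]
    rw [this]
    simp
  | succ R ih =>
    have hfin : {x | G.edist x z ≤ R}.Finite := Set.finite_of_encard_le_coe ih
    have hsub : {x | G.edist x z ≤ (R + 1 : ℕ)} ⊆
        ⋃ y ∈ hfin.toFinset, {y} ∪ G.neighborSet y := by
      intro x hx
      have hx' : G.edist x z ≤ (R + 1 : ℕ) := hx
      obtain ⟨w, hw⟩ := SimpleGraph.exists_walk_of_edist_ne_top
        (ne_top_of_le_ne_top (ENat.natCast_ne_top _) hx')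
      rw [← hw] at hx'
      have hlen : w.length ≤ R + 1 := by exact_mod_cast hx'
      cases w with
      | nil =>
        refine Set.mem_iUnion₂.2 ⟨z, ?_, Or.inl rfl⟩
        simp
      | cons h w' =>
        rename_i v
        refine Set.mem_iUnion₂.2 ⟨v, ?_, Or.inr h.symm⟩
        rw [Set.Finite.mem_toFinset]
        refine (SimpleGraph.edist_le w').trans ?_
        simp only [SimpleGraph.Walk.length_cons] at hlen
        exact_mod_cast Nat.le_of_succ_le_succ hlen
    refine (Set.encard_le_encard hsub).trans ((encard_biUnion_le_card_mul _ _ (k := d + 1)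
      fun y _ => ?_).trans ?_)
    · refine (Set.encard_union_le _ _).trans ?_
      rw [Set.encard_singleton, add_comm]
      gcongr
      exact hd y
    · rw [hfin.encard_eq_coe_toFinset_card] at ih
      rw [pow_succ]
      push_cast at ih ⊢
      gcongr

open Finset Classical in
/-- The co-area inequality: a lower bound for the edge boundaries of small sets gives a lower bound
for the total variation of nonnegative functions with small support. -/
theorem mul_sum_le_sum_abs_sub {V : Type*} [Fintype V] {G : SimpleGraph V} {c : ℝ} {k : ℕ}
    (hexp : ∀ S : Set V, 2 * S.ncard ≤ k → c * S.ncard ≤ (edgeBoundary G S).ncard)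
    (f : V → ℝ) (hf : ∀ v, 0 ≤ f v) (hsupp : 2 * {v | f v ≠ 0}.ncard ≤ k) :
    c * ∑ v, f v ≤ ∑ q : V × V with G.Adj q.1 q.2, |f q.1 - f q.2| := by
  induction hn : {v | f v ≠ 0}.ncard using Nat.strong_induction_on generalizing f with
  | _ n ih =>
    obtain ⟨S, hS⟩ : ∃ S : Set V, S = {v | f v ≠ 0} := ⟨_, rfl⟩
    rw [← hS] at hsupp hn
    have hmem : ∀ v, v ∈ S ↔ f v ≠ 0 := fun v => by rw [hS]; rfl
    rcases S.eq_empty_or_nonempty with h0 | hne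
    · have hz : ∀ v, f v = 0 := fun v => by
        by_contra h
        exact (h0 ▸ (hmem v).2 h : v ∈ (∅ : Set V))
      simp [hz]
    · obtain ⟨v₀, hv₀, hmin⟩ := Set.exists_min_image S f (Set.toFinite _) hne
      set a := f v₀
      have ha : 0 < a := lt_of_le_of_ne (hf v₀) (Ne.symm ((hmem _).1 hv₀))
      set g : V → ℝ := fun v => if v ∈ S then f v - a else 0
      have hgS : ∀ v ∈ S, g v = f v - a := fun v hv => if_pos hv
      have hgS' : ∀ v ∉ S, g v = 0 := fun v hv => if_neg hv
      have hfS' : ∀ v ∉ S, f v = 0 := fun v hv => not_not.1 (mt (hmem v).2 hv)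
      have hg : ∀ v, 0 ≤ g v := fun v => by
        by_cases hv : v ∈ S
        · rw [hgS v hv]; exact sub_nonneg.2 (hmin v hv)
        · rw [hgS' v hv]
      have hgsub : {v | g v ≠ 0} ⊂ S := by
        refine ⟨fun v hv => ?_, fun h => ?_⟩
        · by_contra hvS
          exact hv (hgS' v hvS)
        · exact h hv₀ (by rw [hgS v₀ hv₀, sub_self])
      have hlt := Set.ncard_lt_ncard hgsub (Set.toFinite _)
      have hind := ih _ (hn ▸ hlt) g hg (by omega) rfl
      have hsum : ∑ v, f v = a * S.ncard + ∑ v, g v := by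
        have : ∀ v, f v = (if v ∈ S then a else 0) + g v := fun v => by
          by_cases hv : v ∈ S
          · rw [if_pos hv, hgS v hv]; ring
          · rw [if_neg hv, hgS' v hv, hfS' v hv]; ring
        rw [sum_congr rfl fun v _ => this v, sum_add_distrib, ← sum_filter, sum_const,
          nsmul_eq_mul, mul_comm, Set.ncard_eq_toFinset_card']
        congr 4
        ext v
        simp
      have hvar : ∑ q : V × V with G.Adj q.1 q.2, |g q.1 - g q.2| +
          a * (edgeBoundary G S).ncard ≤ ∑ q : V × V with G.Adj q.1 q.2, |f q.1 - f q.2| := by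
        have hb : a * (edgeBoundary G S).ncard =
            ∑ q : V × V with G.Adj q.1 q.2, if q.1 ∈ S ∧ q.2 ∉ S then a else 0 := by
          rw [← sum_filter, sum_const, nsmul_eq_mul, mul_comm, Set.ncard_eq_toFinset_card']
          congr 2
          refine congrArg card ?_
          ext q
          rw [Set.mem_toFinset, mem_filter, mem_filter]
          simp only [edgeBoundary, Set.mem_ofPred_eq, mem_univ, true_and]
          tauto
        rw [hb, ← sum_add_distrib]
        refine sum_le_sum fun q _ => ?_
        by_cases h1 : q.1 ∈ S <;> by_cases h2 : q.2 ∈ S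
        · rw [hgS _ h1, hgS _ h2]; simp [h2]
        · have := hmin _ h1
          rw [hgS _ h1, hgS' _ h2, hfS' _ h2, if_pos ⟨h1, h2⟩, sub_zero, sub_zero,
            abs_of_nonneg (sub_nonneg.2 this), abs_of_nonneg (hf _)]
          linarith
        · have := hmin _ h2
          rw [hgS' _ h1, hgS _ h2, hfS' _ h1, if_neg (by tauto), zero_sub, zero_sub, abs_neg,
            abs_neg, abs_of_nonneg (sub_nonneg.2 this), abs_of_nonneg (hf _)]
          linarith
        · rw [hgS' _ h1, hgS' _ h2, hfS' _ h1, hfS' _ h2]; simp [h1]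
      have hbd := hexp S (hn ▸ hsupp)
      calc c * ∑ v, f v = c * ∑ v, g v + a * (c * S.ncard) := by rw [hsum]; ring
        _ ≤ _ := add_le_add hind (mul_le_mul_of_nonneg_left hbd ha.le)
        _ ≤ _ := hvar

theorem summable_toReal_pmf {Z : Type*} (p : PMF Z) : Summable fun z => (p z).toReal :=
  ENNReal.summable_toReal (by rw [p.tsum_coe]; exact ENNReal.one_ne_top)

theorem tsum_toReal_pmf {Z : Type*} (p : PMF Z) : ∑' z, (p z).toReal = 1 := by
  rw [← ENNReal.tsum_toReal_eq fun z => p.apply_ne_top z, p.tsum_coe, ENNReal.toReal_one]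

-- The co-area inequality is applied to `v ↦ P v z` for each `z` and summed over `z`; the left sides
-- add up to `c * card V` because each `P v` has mass `1`.
open Finset Classical in
theorem mul_card_le_sum_l1Dist {V Z : Type*} [Fintype V] {G : SimpleGraph V} {c : ℝ} {k : ℕ}
    (hexp : ∀ S : Set V, 2 * S.ncard ≤ k → c * S.ncard ≤ (edgeBoundary G S).ncard)
    (P : V → PMF Z) (hsupp : ∀ z, 2 * {v | z ∈ (P v).support}.ncard ≤ k) :
    c * Fintype.card V ≤ ∑ q : V × V with G.Adj q.1 q.2, l1Dist (P q.1) (P q.2) := by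
  have hs : ∀ v, Summable fun z => (P v z).toReal := fun v => summable_toReal_pmf _
  have hs2 : ∀ q : V × V, Summable fun z => |(P q.1 z).toReal - (P q.2 z).toReal| :=
    fun q => ((hs _).sub (hs _)).abs
  have h1 : c * Fintype.card V = ∑' z, c * ∑ v, (P v z).toReal := by
    rw [tsum_mul_left, Summable.tsum_finsetSum fun v _ => hs v]
    simp [tsum_toReal_pmf]
  have h2 : ∑ q : V × V with G.Adj q.1 q.2, l1Dist (P q.1) (P q.2) =
      ∑' z, ∑ q : V × V with G.Adj q.1 q.2, |(P q.1 z).toReal - (P q.2 z).toReal| := by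
    rw [Summable.tsum_finsetSum fun q _ => hs2 q]
    rfl
  rw [h1, h2]
  refine Summable.tsum_le_tsum (fun z => ?_) ((summable_sum fun v _ => hs v).mul_left c)
    (summable_sum fun q _ => hs2 q)
  refine mul_sum_le_sum_abs_sub hexp (fun v => (P v z).toReal) (fun v => ENNReal.toReal_nonneg) ?_
  convert hsupp z using 3
  ext v
  rw [Set.mem_ofPred_eq, Set.mem_ofPred_eq, PMF.mem_support_iff, ne_eq, ENNReal.toReal_eq_zero_iff,
    or_iff_left ((P v).apply_ne_top z)]

/-! ### The failure of uniform amenability -/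

theorem exists_zsmul_of_rotationGraph_reachable {x y : UnitAddCircle}
    (h : (rotationGraph θ).Reachable x y) : ∃ j : ℤ, y = x + j • (θ : UnitAddCircle) := by
  obtain ⟨w⟩ := h
  induction w with
  | nil => exact ⟨0, by simp⟩
  | cons h _ ih =>
    obtain ⟨k, hk⟩ := ih
    rcases (rotationGraph_adj.1 h).2 with h | h
    · exact ⟨1 + k, by rw [hk, h, add_zsmul, one_zsmul, add_assoc]⟩
    · exact ⟨-1 + k, by rw [hk, h, add_zsmul, neg_one_zsmul]; abel⟩

/-- Countably many rotated copies of `B` cover the circle. -/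
theorem volume_ne_zero_of_forall_edist_le {B : Set UnitAddCircle} {C : ℕ}
    (h : ∀ x, ∃ y ∈ B, (rotationGraph θ).edist x y ≤ C) : volume B ≠ 0 := by
  intro h0
  have hcov : (Set.univ : Set UnitAddCircle) ⊆
      ⋃ j : ℤ, (fun x => x + j • (θ : UnitAddCircle)) ⁻¹' B := by
    intro x _
    obtain ⟨y, hy, hxy⟩ := h x
    obtain ⟨j, hj⟩ := exists_zsmul_of_rotationGraph_reachable
      (SimpleGraph.reachable_of_edist_ne_top (ne_top_of_le_ne_top (ENat.natCast_ne_top _) hxy))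
    exact Set.mem_iUnion.2 ⟨j, by simpa [← hj] using hy⟩
  have : volume (Set.univ : Set UnitAddCircle) = 0 := measure_mono_null hcov
    (measure_iUnion_null fun j => by rw [measure_preimage_add_right, h0])
  simp at this

open Finset Classical in
theorem not_isUniformlyAmenable_Hhat (hY : ∀ n, MeasurableSet (Y n))
    (hT : IsCubicExpanderSequence N T)
    (hvol : ∀ n, volume (Y n) ≤ ENNReal.ofReal (1 / (2 ^ (n + 1) * N n)))
    (hYpos : ∀ n, volume (Y n) ≠ 0) (hdeg : HasBoundedDegree (Hhat θ T Y)) :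
    ¬ IsUniformlyAmenable (Hhat θ T Y) (nuHat N Y) := by
  obtain ⟨hmono, hN, -, c, hc, hexp⟩ := hT
  obtain ⟨d, hd⟩ := hdeg
  intro h
  obtain ⟨R, -, Z, hZ, hZ0, -, p, -, hp, hsum⟩ := h (c / 2) (by positivity)
  set M := (d + 1) ^ R
  -- `M` bounds the size of balls of radius `R`. Since `N` is strictly increasing, `N n ≥ n`, so `M`
  -- vertices are at most half of `T n`.
  set n := 2 * M
  have hNn : 2 * M ≤ N n := hmono.le_apply
  -- `Y n` is not null, while the points with some vertex of their fibre outside `Z` form a null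
  -- set.
  obtain ⟨s, hs⟩ : ∃ s : Y n, ∀ i, (.inr ⟨n, s, i⟩ : Xhat N Y) ∈ Z := by
    by_contra! hcon
    refine hYpos n (measure_mono_null (t := ⋃ i, slice Zᶜ n i) ?_
      (measure_iUnion_null fun i => ((nuHat_eq_zero_iff hY hN hvol hZ.compl).1 hZ0).2 n i))
    intro s hs
    obtain ⟨i, hi⟩ := hcon ⟨s, hs⟩
    exact Set.mem_iUnion.2 ⟨i, hs, hi⟩
  set x : Fin (N n) → Z := fun i => ⟨.inr ⟨n, s, i⟩, hs i⟩ with hx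
  have hxinj : ∀ i j, (x i : Xhat N Y) = x j → i = j := fun i j h => by simpa [hx] using h
  -- The distributions may leave the fibre, but each `z` is within distance `R` of at most `M`
  -- points of the whole graph.
  have hsupp : ∀ z, 2 * {i | z ∈ (p (x i)).support}.ncard ≤ N n := by
    intro z
    have h1 : ((fun i => (x i : Xhat N Y)) '' {i | z ∈ (p (x i)).support}).encard ≤ M :=
      (Set.encard_le_encard (by rintro _ ⟨i, hi, rfl⟩; exact hp (x i) z hi)).trans
        (encard_edist_le_le hd R z)
    rw [Function.Injective.encard_image (fun i j h => hxinj i j h),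
      ← (Set.toFinite _).cast_ncard_eq] at h1
    have : {i | z ∈ (p (x i)).support}.ncard ≤ M := by exact_mod_cast h1
    omega
  have hlow := mul_card_le_sum_l1Dist (G := T n) (hexp n) (fun i => p (x i)) hsupp
  have hl0 : ∀ i j, 0 ≤ l1Dist (p (x i)) (p (x j)) := fun i j => tsum_nonneg fun z => abs_nonneg _
  have hup : ∀ i, ∑ j with (T n).Adj i j, l1Dist (p (x i)) (p (x j)) ≤ c / 2 := by
    intro i
    rw [← ENNReal.ofReal_le_ofReal_iff (by positivity),
      ENNReal.ofReal_sum_of_nonneg fun j _ => hl0 i j]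
    refine le_trans ?_ (hsum (x i))
    let φ : {j // (T n).Adj i j} → {y : Z // (Hhat θ T Y).Adj (x i) y} :=
      fun j => ⟨x j, .fiber n s i j j.2⟩
    have hφ : Function.Injective φ := fun j j' h => Subtype.ext (hxinj _ _
      (congrArg (fun y : {y : Z // (Hhat θ T Y).Adj (x i) y} => (y.1 : Xhat N Y)) h))
    refine le_trans (le_of_eq ?_) (ENNReal.tsum_comp_le_tsum_of_injective hφ
      fun y => ENNReal.ofReal (l1Dist (p (x i)) (p y)))
    rw [tsum_fintype, ← Finset.sum_subtype_eq_sum_filter]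
    simp [φ]
  have htot : ∑ q : Fin (N n) × Fin (N n) with (T n).Adj q.1 q.2, l1Dist (p (x q.1)) (p (x q.2))
      ≤ N n * (c / 2) := by
    rw [sum_filter, Fintype.sum_prod_type]
    calc _ ≤ ∑ i : Fin (N n), c / 2 := sum_le_sum fun i _ => by
          rw [← sum_filter]; exact hup i
      _ = _ := by simp
  have hpos : (0 : ℝ) < N n := by exact_mod_cast hN n
  rw [Fintype.card_fin] at hlow
  nlinarith

/-! ### The failure of bounded type -/

theorem reachable_smul {Γ X : Type*} [Group Γ] [MulAction Γ X] {S : Set Γ}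
    (hS : Subgroup.closure S = ⊤) (γ : Γ) (x : X) : (actionGraph Γ S).Reachable x (γ • x) := by
  have hγ : γ ∈ Subgroup.closure S := hS ▸ Subgroup.mem_top γ
  induction hγ using Subgroup.closure_induction generalizing x with
  | mem σ hσ =>
    by_cases h : x = σ • x
    · rw [← h]
    · exact SimpleGraph.Adj.reachable
        ((SimpleGraph.fromRel_adj _ _ _).2 ⟨h, Or.inl ⟨σ, hσ, rfl⟩⟩)
  | one => rw [one_smul]
  | mul γ δ _ _ hγ hδ => rw [mul_smul]; exact (hδ x).trans (hγ _)
  | inv γ _ hγ =>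
    have := (hγ (γ⁻¹ • x)).symm
    rwa [smul_inv_smul] at this

/-- Group elements move points within components, so quasi-invariance makes the push-forward
absolutely continuous; without this, `rnDeriv` would not see a singular part. -/
theorem measure_preimage_inv_smul_le {Γ X : Type*} [Group Γ] [MulAction Γ X] [MeasurableSpace X]
    {S : Set Γ} {μ : Measure X} (hG : IsMeasuredGraph (actionGraph Γ S) μ)
    (hS : Subgroup.closure S = ⊤) (hmeas : ∀ γ : Γ, Measurable fun x : X => γ • x) {γ : Γ}
    {M : ℝ≥0} (hM : ∀ᵐ x ∂μ, radonNikodym μ γ x ≤ M) {A : Set X} (hA : MeasurableSet A) :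
    μ ((fun x => γ⁻¹ • x) ⁻¹' A) ≤ M * μ A := by
  have := hG.prob
  have hac : (μ.map fun x => γ⁻¹ • x) ≪ μ := by
    refine Measure.AbsolutelyContinuous.mk fun B hB hB0 => ?_
    rw [Measure.map_apply (hmeas _) hB]
    refine measure_mono_null (fun x hx => ?_) (hG.quasiInvariant B hB hB0)
    exact ⟨γ⁻¹ • x, hx, (reachable_smul hS γ⁻¹ x).symm⟩
  rw [← Measure.map_apply (hmeas _) hA, ← Measure.withDensity_rnDeriv_eq _ _ hac,
    withDensity_apply _ hA]
  calc _ ≤ ∫⁻ _ in A, (M : ℝ≥0∞) ∂μ := lintegral_mono_ae (ae_restrict_of_ae hM)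
    _ = _ := by rw [lintegral_const, Measure.restrict_apply_univ]

theorem copy_injective (n : ℕ) (i : Fin (N n)) :
    Function.Injective fun s : Y n => (.inr ⟨n, s, i⟩ : Xhat N Y) := fun s t h => by simpa using h

theorem measurableEmbedding_copy (hY : ∀ n, MeasurableSet (Y n)) (n : ℕ) (i : Fin (N n)) :
    MeasurableEmbedding fun s : Y n => (.inr ⟨n, s, i⟩ : Xhat N Y) := by
  have := standardBorelSpace_Xhat (N := N) hY
  have := (hY n).standardBorel
  exact (measurable_copy n i).measurableEmbedding (copy_injective n i)

theorem nuHat_image_copy (hY : ∀ n, MeasurableSet (Y n)) (n : ℕ) (i : Fin (N n)) {E : Set (Y n)}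
    (hE : MeasurableSet E) :
    nuHat N Y ((fun s : Y n => (.inr ⟨n, s, i⟩ : Xhat N Y)) '' E) =
      (nu N Y Set.univ)⁻¹ * (weight i * N n * volume ((↑) '' E : Set UnitAddCircle)) := by
  set A : Set (Xhat N Y) := (fun s : Y n => (.inr ⟨n, s, i⟩ : Xhat N Y)) '' E
  have hA : MeasurableSet A := (measurableEmbedding_copy hY n i).measurableSet_image.2 hE
  have hinl : (Sum.inl ⁻¹' A : Set UnitAddCircle) = ∅ := by
    ext s
    simp [A]
  have hsl : slice A n i = (↑) '' E := by
    rw [slice_eq_image, Set.preimage_image_eq _ (copy_injective n i)]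
  have hsl' : ∀ k, k ≠ i → slice A n k = ∅ := by
    intro k hk
    ext s
    simp [slice, A, hk.symm]
  have hsl'' : ∀ m (k : Fin (N m)), m ≠ n → slice A m k = ∅ := by
    intro m k hm
    ext s
    simp only [slice, Set.mem_ofPred_eq, Set.mem_empty_iff_false, iff_false]
    rintro ⟨h, t, ht, heq⟩
    simp only [Sum.inr.injEq, Sigma.mk.injEq] at heq
    exact hm heq.1.symm
  rw [nuHat, Measure.smul_apply, smul_eq_mul, copyMeasure_apply hY _ hA, hinl, measure_empty,
    zero_add, tsum_eq_single n, Finset.sum_eq_single i, hsl]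
  · intro k _ hk
    rw [hsl' k hk, measure_empty, mul_zero]
  · simp
  · intro m hm
    exact Finset.sum_eq_zero fun k _ => by rw [hsl'' m k hm, measure_empty, mul_zero]

/-- If `Hhat` is of bounded type, then the weights of adjacent vertices of the attached graphs have
bounded ratios. -/
theorem exists_weight_le_mul_weight_of_adj (hY : ∀ n, MeasurableSet (Y n)) (hN : ∀ n, 0 < N n)
    (hvol : ∀ n, volume (Y n) ≤ ENNReal.ofReal (1 / (2 ^ (n + 1) * N n)))
    (hYpos : ∀ n, volume (Y n) ≠ 0) (h : IsBoundedType (Hhat θ T Y) (nuHat N Y)) :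
    ∃ M : ℝ≥0, ∀ n (i j : Fin (N n)), (T n).Adj i j → weight i ≤ M * weight j := by
  obtain ⟨hdeg, Γ, _, _, S, hSfin, hSinv, hS, hmeas, hgraph, hbdd⟩ := h
  have hG : IsMeasuredGraph (actionGraph Γ S) (nuHat N Y) := by
    rw [hgraph]
    exact isMeasuredGraph_Hhat hY hN hvol hdeg
  have := hG.standardBorel
  choose M hM using hbdd
  -- The maximum over the finite generating set serves all `n` at once.
  refine ⟨hSfin.toFinset.sup M, fun n i j hij => ?_⟩
  set E : Γ → Set (Y n) := fun σ =>
    {s | σ • (.inr ⟨n, s, j⟩ : Xhat N Y) = (.inr ⟨n, s, i⟩ : Xhat N Y)}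
  have hE : ∀ σ, MeasurableSet (E σ) := fun σ =>
    measurableSet_eq_fun ((hmeas σ).comp (measurable_copy n j)) (measurable_copy n i)
  have hcov : Y n ⊆ ⋃ σ ∈ S, (↑) '' E σ := by
    intro s hs
    have hadj : (actionGraph Γ S).Adj (.inr ⟨n, ⟨s, hs⟩, j⟩ : Xhat N Y)
        (.inr ⟨n, ⟨s, hs⟩, i⟩ : Xhat N Y) := by
      rw [hgraph]
      exact .fiber n ⟨s, hs⟩ j i hij.symm
    rcases ((SimpleGraph.fromRel_adj _ _ _).1 hadj).2 with ⟨σ, hσ, h⟩ | ⟨σ, hσ, h⟩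
    · exact Set.mem_iUnion₂.2 ⟨σ, hσ, ⟨s, hs⟩, h.symm, rfl⟩
    · exact Set.mem_iUnion₂.2 ⟨σ⁻¹, hSinv σ hσ, ⟨s, hs⟩, by
        simp only [E, Set.mem_ofPred_eq]; rw [h, inv_smul_smul], rfl⟩
  -- Every edge from copy `j` to copy `i` is realized by a generator, so one `σ` realizes it on a
  -- set of positive measure. There the masses of the two copies are in the ratio of the weights.
  obtain ⟨σ, hσ, hpos⟩ : ∃ σ ∈ S, volume ((↑) '' E σ : Set UnitAddCircle) ≠ 0 := by
    by_contra! hcon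
    exact hYpos n (measure_mono_null hcov ((measure_biUnion_null_iff hSfin.countable).2 hcon))
  set v := volume ((↑) '' E σ : Set UnitAddCircle)
  have hle := measure_preimage_inv_smul_le hG hS hmeas (hM σ)
    ((measurableEmbedding_copy hY n j).measurableSet_image.2 (hE σ))
  have hsub : (fun s : Y n => (.inr ⟨n, s, i⟩ : Xhat N Y)) '' E σ ⊆ (fun x => σ⁻¹ • x) ⁻¹'
      ((fun s : Y n => (.inr ⟨n, s, j⟩ : Xhat N Y)) '' E σ) := by
    rintro _ ⟨s, hs, rfl⟩
    refine ⟨s, hs, ?_⟩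
    have hs' : σ • (.inr ⟨n, s, j⟩ : Xhat N Y) = (.inr ⟨n, s, i⟩ : Xhat N Y) := hs
    simp only
    rw [← hs', inv_smul_smul]
  have hle' := (measure_mono hsub).trans hle
  rw [nuHat_image_copy hY n i (hE σ), nuHat_image_copy hY n j (hE σ)] at hle'
  set q := (nu N Y Set.univ)⁻¹ * (N n * v)
  have hq0 : q ≠ 0 := mul_ne_zero (ENNReal.inv_ne_zero.2 (nu_univ_ne_top hY hN hvol))
    (mul_ne_zero (by exact_mod_cast (hN n).ne') hpos)
  have hqt : q ≠ ∞ := ENNReal.mul_ne_top (ENNReal.inv_ne_top.2 (nu_univ_ne_zero hY))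
    (ENNReal.mul_ne_top (ENNReal.natCast_ne_top _) (measure_ne_top _ _))
  have hcancel : weight i * q ≤ M σ * weight j * q := by
    have e : ∀ w : ℝ≥0∞, (nu N Y Set.univ)⁻¹ * (w * N n * v) = w * q := fun w => by
      rw [mul_assoc w, mul_left_comm]
    rw [e, e] at hle'
    rwa [mul_assoc]
  have hMσ : (M σ : ℝ≥0∞) ≤ (hSfin.toFinset.sup M : ℝ≥0) := by
    exact_mod_cast Finset.le_sup (f := M) (hSfin.mem_toFinset.2 hσ)
  refine ((ENNReal.mul_le_mul_iff_left hq0 hqt).1 hcancel).trans ?_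
  gcongr

/-- Geometric decay turns a bounded ratio of weights into a bounded difference of numbers; the extra
`1` is the factor `2` lost to the last vertex. -/
theorem le_add_of_weight_le {k L : ℕ} {i j : Fin k} (h : weight i ≤ 2 ^ L * weight j) :
    j.val ≤ i.val + (L + 1) := by
  by_contra! hlt
  have h1 : (2⁻¹ : ℝ≥0∞) ^ (i.val + 1) ≤ 2⁻¹ ^ (i.val + 2) :=
    calc (2⁻¹ : ℝ≥0∞) ^ (i.val + 1) ≤ weight i := two_inv_pow_succ_le_weight i
      _ ≤ 2 ^ L * weight j := h
      _ ≤ 2 ^ L * 2⁻¹ ^ j.val := by gcongr; exact weight_le_two_inv_pow j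
      _ ≤ 2 ^ L * 2⁻¹ ^ (L + (i.val + 2)) := by
        gcongr 2 ^ L * ?_
        exact pow_le_pow_right_of_le_one' (by simp) (by omega)
      _ = 2⁻¹ ^ (i.val + 2) := by
        rw [pow_add, ← mul_assoc, ← mul_pow, ENNReal.mul_inv_cancel two_ne_zero (by simp), one_pow,
          one_mul]
  refine absurd h1 (not_le.2 ?_)
  rw [← two_inv_pow_add_self (i.val + 1)]
  exact ENNReal.lt_add_right (by simp) (by simp)

open Finset in
theorem not_isBoundedType_Hhat (hY : ∀ n, MeasurableSet (Y n))
    (hT : IsCubicExpanderSequence N T)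
    (hvol : ∀ n, volume (Y n) ≤ ENNReal.ofReal (1 / (2 ^ (n + 1) * N n)))
    (hYpos : ∀ n, volume (Y n) ≠ 0) : ¬ IsBoundedType (Hhat θ T Y) (nuHat N Y) := by
  intro h
  obtain ⟨hmono, hN, -, c, hc, hexp⟩ := hT
  obtain ⟨M, hM⟩ := exists_weight_le_mul_weight_of_adj hY hN hvol hYpos h
  obtain ⟨L, hL⟩ := pow_unbounded_of_one_lt M (one_lt_two : (1 : ℝ≥0) < 2)
  have hband : ∀ n (i j : Fin (N n)), (T n).Adj i j → j.val ≤ i.val + (L + 1) := by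
    intro n i j hij
    refine le_add_of_weight_le ((hM n i j hij).trans ?_)
    gcongr
    exact_mod_cast hL.le
  -- Edges leaving the first `l` vertices join the last `L + 1` of these to the next `L + 1`, so
  -- there are at most `(L + 1) ^ 2`. With `l ≥ K` and `c * K > (L + 1) ^ 2` this contradicts
  -- expansion.
  obtain ⟨K, hK⟩ := exists_nat_gt (((L + 1) * (L + 1) : ℕ) / c)
  have hNn : 2 * K ≤ N (2 * K) := hmono.le_apply
  set n := 2 * K
  set l := N n / 2
  set S : Set (Fin (N n)) := {i | i.val < l}
  have hS : S.ncard = l := by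
    have : Fin.val '' S = ((range l : Finset ℕ) : Set ℕ) := by
      ext m
      simp only [S, Set.mem_image, Set.mem_ofPred_eq, coe_range, Set.mem_Iio]
      exact ⟨by rintro ⟨i, hi, rfl⟩; exact hi, fun hm => ⟨⟨m, by omega⟩, hm, rfl⟩⟩
    rw [← Set.ncard_image_of_injective S Fin.val_injective, this, Set.ncard_coe_finset, card_range]
  have hb : (edgeBoundary (T n) S).ncard ≤ (L + 1) * (L + 1) := by
    have hsub : Prod.map Fin.val Fin.val '' edgeBoundary (T n) S ⊆
        ((Ico (l - (L + 1)) l ×ˢ Ico l (l + (L + 1)) : Finset (ℕ × ℕ)) : Set (ℕ × ℕ)) := by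
      rintro _ ⟨⟨i, j⟩, ⟨hi, hj, hij⟩, rfl⟩
      have hi' : i.val < l := hi
      have hj' : ¬ j.val < l := hj
      have := hband n i j hij
      simp only [Prod.map, coe_product, coe_Ico, Set.mem_prod, Set.mem_Ico]
      omega
    rw [← Set.ncard_image_of_injective _ (Fin.val_injective.prodMap Fin.val_injective)]
    refine (Set.ncard_le_ncard hsub (Set.toFinite _)).trans ?_
    rw [Set.ncard_coe_finset, card_product, Nat.card_Ico, Nat.card_Ico]
    gcongr <;> omega
  have h1 : c * S.ncard ≤ (edgeBoundary (T n) S).ncard := hexp n S (by omega)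
  rw [hS] at h1
  have h2 : ((edgeBoundary (T n) S).ncard : ℝ) ≤ ((L + 1) * (L + 1) : ℕ) := by exact_mod_cast hb
  have h3 : (K : ℝ) ≤ l := by exact_mod_cast (by omega : K ≤ l)
  rw [div_lt_iff₀ hc] at hK
  nlinarith

/-- The properties of the rotation graph with expanders attached. -/
theorem Hhat_properties (hθ : Irrational θ) (hT : IsCubicExpanderSequence N T)
    (hY : IsMarkerSequence θ N Y) :
    IsMeasuredGraph (Hhat θ T Y) (nuHat N Y) ∧ HasBoundedDegree (Hhat θ T Y) ∧
      nuHat N Y ≪ muHat N Y ∧ muHat N Y ≪ nuHat N Y ∧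
      IsUniformlyHyperfinite (Hhat θ T Y) (nuHat N Y) ∧
      ¬ IsUniformlyAmenable (Hhat θ T Y) (nuHat N Y) ∧
      ¬ IsBoundedType (Hhat θ T Y) (nuHat N Y) := by
  obtain ⟨hYm, hC, hvol, D, hD⟩ := hY
  have hN := hT.2.1
  have hYpos : ∀ n, volume (Y n) ≠ 0 := fun n =>
    volume_ne_zero_of_forall_edist_le (hC n).choose_spec
  have hdeg : HasBoundedDegree (Hhat θ T Y) :=
    hasBoundedDegree_Hhat hN hT.2.2.1 hD
  exact ⟨isMeasuredGraph_Hhat hYm hN hvol hdeg, hdeg,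
    nuHat_absolutelyContinuous_muHat hYm hN hvol,
    muHat_absolutelyContinuous_nuHat hYm hN hvol,
    isUniformlyHyperfinite_Hhat hθ hYm hN hvol hD,
    not_isUniformlyAmenable_Hhat hYm hT hvol hYpos hdeg,
    not_isBoundedType_Hhat hYm hT hvol hYpos⟩

end UniformHyperfinite

theorem mainTheorem4 :
    (∀ (θ : ℝ) (N : ℕ → ℕ) (T : ∀ n, SimpleGraph (Fin (N n))) (Y : ℕ → Set UnitAddCircle),
      Irrational θ →
      UniformHyperfinite.IsCubicExpanderSequence N T →
      UniformHyperfinite.IsMarkerSequence θ N Y →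
        UniformHyperfinite.IsMeasuredGraph (UniformHyperfinite.Hhat θ T Y)
          (UniformHyperfinite.nuHat N Y) ∧
        UniformHyperfinite.HasBoundedDegree (UniformHyperfinite.Hhat θ T Y) ∧
        UniformHyperfinite.nuHat N Y ≪ UniformHyperfinite.muHat N Y ∧
        UniformHyperfinite.muHat N Y ≪ UniformHyperfinite.nuHat N Y ∧
        UniformHyperfinite.IsUniformlyHyperfinite (UniformHyperfinite.Hhat θ T Y)
          (UniformHyperfinite.nuHat N Y) ∧
        ¬ UniformHyperfinite.IsUniformlyAmenable (UniformHyperfinite.Hhat θ T Y)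
          (UniformHyperfinite.nuHat N Y) ∧
        ¬ UniformHyperfinite.IsBoundedType (UniformHyperfinite.Hhat θ T Y)
          (UniformHyperfinite.nuHat N Y)) ∧
    ∃ (X : Type) (_ : MeasurableSpace X) (G : SimpleGraph X) (μ : Measure X),
      UniformHyperfinite.IsMeasuredGraph G μ ∧
      UniformHyperfinite.HasBoundedDegree G ∧
      UniformHyperfinite.IsUniformlyHyperfinite G μ ∧
      ¬ UniformHyperfinite.IsUniformlyAmenable G μ ∧
      ¬ UniformHyperfinite.IsBoundedType G μ := by
  refine ⟨fun θ N T Y hθ hT hY => UniformHyperfinite.Hhat_properties hθ hT hY, ?_⟩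
  obtain ⟨N, T, hT⟩ := UniformHyperfinite.exists_isCubicExpanderSequence
  obtain ⟨Y, hY⟩ := UniformHyperfinite.exists_isMarkerSequence irrational_sqrt_two hT.2.1
  obtain ⟨h1, h2, -, -, h3, h4, h5⟩ :=
    UniformHyperfinite.Hhat_properties irrational_sqrt_two hT hY
  exact ⟨_, _, _, _, h1, h2, h3, h4, h5⟩
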